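/- Let $\Sigma$ be a finite alphabet with $|\Sigma|\ge 2$ and let $h\ge 1$. An $h$-head finite-state gambler ($h$-FSG) $G$ over $\Sigma$ consists of nonempty finite sets $T,Q$, maps $\delta_T:T\to T$ and $\delta_Q:Q\times\Sigma^h\to Q$, a movement function $\mu:T\to\{0,1\}^{h-1}$, a betting function $\beta$ that assigns to each $q\in Q$ a rational-valued probability distribution $\beta(q)$ on $\Sigma$, an initial state $(t_0,q_0)\in T\times Q$, and an initial capital $c_0\ge 0$. Put $\pi(0)=(0,\dots,0)\in\mathbb{N}^{h-1}$ and $\pi(n+1)=\pi(n)+\mu(\delta_T^{\,n}(t_0))$. On $S\in\Sigma^\omega$ the states are $t_{n+1}=\delta_T(t_n)$ and $q_{n+1}=\delta_Q(q_n,(S[\pi_1(n)],\dots,S[\pi_{h-1}(n)],S[n]))$; the state $q_n$ depends only on the first $n$ symbols of $S$. The martingale of $G$ is $d_G(\lambda)=c_0$, $d_G(wb)=|\Sigma|\,d_G(w)\,\beta(q_{|w|})(b)$, and its $s$-gale is $d_G^{(s)}(w)=|\Sigma|^{(s-1)|w|}d_G(w)$. For $E\subseteq\Sigma^\omega$, the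 $h$-head finite-state predimension $\dim^{(h)}(E)$ is the infimum of all $s\in[0,\infty)$ for which some $h$-FSG $G$ satisfies $\limsup_n d_G^{(s)}(S[0..n-1])=\infty$ for every $S\in E$; the strong predimension $\mathrm{Dim}^{(h)}(E)$ is defined in the same way with $\liminf$ in place of $\limsup$. A function $\dim$ of sets of sequences is stable under finite unions if $\dim(E\cup F)=\max\{\dim(E),\dim(F)\}$ for all $E,F$. Let $p_i$ be the $i$-th prime ($p_1=2$). For $S\in\{0,1\}^\omega$ let $F'_{h+1}(S)[0]=F''_{h+1}(S)[0]=S[0]$; for $q\ge 0$ and $0<r<p_{h+1}$ let $F'_{h+1}(S)[qp_{h+1}+r]=F''_{h+1}(S)[qp_{h+1}+r]=S[q(p_{h+1}-1)+r]$; and for $q\ge1$ let $F'_{h+1}(S)[qp_{h+1}]=\bigoplus_{k=1}^{h-1}F'_{h+1}(S)[qp_k]$ and $F''_{h+1}(S)[qp_{h+1}]=\bigoplus_{k=2}^{h}F''_{h+1}(S)[qp_k]$, where $\oplus$ is parity. A sequence $R\in\{0,1\}^\omega$ is Martin-Löf random if there is $c\in\mathbb{N}$ with $K(R[0..n-1])\ge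 n-c$ for all $n$, where $K$ is prefix Kolmogorov complexity with respect to a fixed universal prefix machine. **Theorem.** For every integer $h\ge2$, neither $\dim^{(h)}$ nor $\mathrm{Dim}^{(h)}$, over the binary alphabet, is stable under finite unions. Moreover, for every Martin-Löf random $R$ and every $h\ge 2$, the sequences $X=F'_{h+1}(R)$ and $Z=F''_{h+1}(R)$ satisfy $$\dim^{(h)}(\{X\}),\ \mathrm{Dim}^{(h)}(\{X\}),\ \dim^{(h)}(\{Z\}),\ \mathrm{Dim}^{(h)}(\{Z\})\ \le\ 1-\frac1{p_{h+1}},$$ $$\dim^{(h)}(\{X,Z\})=\mathrm{Dim}^{(h)}(\{X,Z\})=1.$$ -/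

import Mathlib

open Filter
open scoped ENNReal NNReal

/-! ### Multihead finite-state gamblers -/

/-- An `h`-head finite-state gambler (`h ≥ 1`) over a finite alphabet `A` with at least two symbols.
There are `h - 1` trailing heads, indexed by `Fin (h - 1)`, and one leading head; an element of
`A ^ h` is given by the `h - 1` symbols under the trailing heads and the symbol under the leading
head. -/
structure MultiheadFSG (h : ℕ) (A : Type) [Fintype A] [Nontrivial A] where
  /-- positional states -/
  T : Type
  /-- betting states -/
  Q : Type
  finite_T : Finite T
  finite_Q : Finite Q
  /-- the positional component of the transition function -/
  δT : T → T
  /-- the other component of the transition function -/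
  δQ : Q → (Fin (h - 1) → A) → A → Q
  /-- the movement function: `true` means that the trailing head advances -/
  μ : T → Fin (h - 1) → Bool
  /-- the betting function, with values in the rational probability distributions on `A` -/
  β : Q → A → ℚ≥0
  sum_β : ∀ q, ∑ a, β q a = 1
  /-- initial positional state -/
  t₀ : T
  /-- initial betting state -/
  q₀ : Q
  /-- initial capital -/
  c₀ : ℝ≥0

namespace MultiheadFSG

variable {h : ℕ} {A : Type} [Fintype A] [Nontrivial A]

/-- The transition function on `T × Q`. -/
def δ (G : MultiheadFSG h A) (s : G.T × G.Q) (σ : Fin (h - 1) → A) (a : A) : G.T × G.Q :=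
  (G.δT s.1, G.δQ s.2 σ a)

/-- Positions of the trailing heads after `n` steps. -/
def pos (G : MultiheadFSG h A) : ℕ → Fin (h - 1) → ℕ
  | 0, _ => 0
  | n + 1, i => G.pos n i + (G.μ (G.δT^[n] G.t₀) i).toNat

theorem pos_le (G : MultiheadFSG h A) (n : ℕ) (i : Fin (h - 1)) : G.pos n i ≤ n := by
  induction n with
  | zero => simp [pos]
  | succ n ih =>
    have := Bool.toNat_le (G.μ (G.δT^[n] G.t₀) i)
    simp only [pos]
    omega

/-- The state of `G` after the leading head has read the string `w` of length `n`. In the step that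
reads the last symbol of a string of length `n + 1`, the leading head is at position `n` and
trailing head `i` at position `G.pos n i ≤ n`. -/
def state (G : MultiheadFSG h A) : (n : ℕ) → (Fin n → A) → G.T × G.Q
  | 0, _ => (G.t₀, G.q₀)
  | n + 1, w =>
    G.δ (G.state n (Fin.init w))
      (fun i => w ⟨G.pos n i, Nat.lt_succ_of_le (G.pos_le n i)⟩) (w (Fin.last n))

/-- The martingale of `G`, on strings of length `n`. -/
noncomputable def martingale (G : MultiheadFSG h A) : (n : ℕ) → (Fin n → A) → ℝ≥0
  | 0, _ => G.c₀
  | n + 1, w =>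
    (Fintype.card A : ℝ≥0) * G.martingale n (Fin.init w) *
      (G.β (G.state n (Fin.init w)).2 (w (Fin.last n)) : ℝ≥0)

/-- The `s`-gale of `G`, on strings of length `n`. -/
noncomputable def gale (G : MultiheadFSG h A) (s : ℝ) (n : ℕ) (w : Fin n → A) : ℝ≥0 :=
  (Fintype.card A : ℝ≥0) ^ ((s - 1) * (n : ℝ)) * G.martingale n w

end MultiheadFSG

/-! ### Success sets and predimensions -/

/-- The success set of a function on strings. -/
def successSet {A : Type} (d : (n : ℕ) → (Fin n → A) → ℝ≥0) : Set (ℕ → A) :=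
  {S | limsup (fun n : ℕ => (d n (fun i => S i) : ℝ≥0∞)) atTop = ⊤}

/-- The strong success set of a function on strings. -/
def strongSuccessSet {A : Type} (d : (n : ℕ) → (Fin n → A) → ℝ≥0) : Set (ℕ → A) :=
  {S | liminf (fun n : ℕ => (d n (fun i => S i) : ℝ≥0∞)) atTop = ⊤}

/-- The `h`-head finite-state predimension of a set of sequences. The set of admissible `s` is never
empty: it contains every `s > 1`, by uniform betting. -/
noncomputable def predim {A : Type} [Fintype A] [Nontrivial A] (h : ℕ) (E : Set (ℕ → A)) : ℝ :=
  sInf {s : ℝ | 0 ≤ s ∧ ∃ G : MultiheadFSG h A, E ⊆ successSet (G.gale s)}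

/-- The `h`-head finite-state strong predimension of a set of sequences. -/
noncomputable def strongPredim {A : Type} [Fintype A] [Nontrivial A] (h : ℕ)
    (E : Set (ℕ → A)) : ℝ :=
  sInf {s : ℝ | 0 ≤ s ∧ ∃ G : MultiheadFSG h A, E ⊆ strongSuccessSet (G.gale s)}

/-- Stability of a dimension notion under finite unions. -/
def StableUnderUnions {A : Type} (dim : Set (ℕ → A) → ℝ) : Prop :=
  ∀ E F : Set (ℕ → A), dim (E ∪ F) = max (dim E) (dim F)

/-! ### Prefix Kolmogorov complexity and Martin-Löf randomness -/

/-- A prefix machine: a partial computable function of a program and an auxiliary input, such that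
for each auxiliary input the set of halting programs is prefix-free. -/
def IsPrefixMachine (M : List Bool → List Bool →. List Bool) : Prop :=
  Partrec₂ M ∧ ∀ τ π₁ π₂ : List Bool, (M π₁ τ).Dom → (M π₂ τ).Dom → π₁ <+: π₂ → π₁ = π₂

/-- The conditional complexity `K_M(σ ∣ τ)`, the least length of a program for `σ` given `τ`;
it is `⊤` if there is no such program. -/
noncomputable def condK (M : List Bool → List Bool →. List Bool) (σ τ : List Bool) : ℕ∞ :=
  ⨅ π ∈ {π : List Bool | σ ∈ M π τ}, (π.length : ℕ∞)

/-- A universal prefix machine: it simulates each prefix machine at an additive constant cost in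
program length. -/
def IsUniversalPrefixMachine (U : List Bool → List Bool →. List Bool) : Prop :=
  IsPrefixMachine U ∧ ∀ M, IsPrefixMachine M → ∃ c : ℕ, ∀ σ τ, condK U σ τ ≤ condK M σ τ + c

/-- Martin-Löf randomness of `R`, for complexity with respect to the universal prefix machine `U`:
`K(R[0..n-1]) ≥ n - c` for some constant `c` and all `n`. -/
def IsMartinLofRandom (U : List Bool → List Bool →. List Bool) (R : ℕ → Bool) : Prop :=
  ∃ c : ℕ, ∀ n : ℕ, (n : ℕ∞) ≤ condK U (List.ofFn fun i : Fin n => R i) [] + c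

/-! ### The sequence transformations -/

/-- The `i`-th prime number, for `i ≥ 1`: `prm 1 = 2`, `prm 2 = 3`, and so on. -/
noncomputable def prm (i : ℕ) : ℕ := Nat.nth Nat.Prime (i - 1)

theorem prm_lt {h k : ℕ} (hk : k ∈ Finset.Icc 1 h) : prm k < prm (h + 1) := by
  rw [Finset.mem_Icc] at hk
  exact Nat.nth_strictMono Nat.infinite_setOfPred_prime (by omega)

/-- For a set `K` of indices in `{1, …, h}`, the sequence `Y` with `Y[0] = S[0]` that takes new bits
from `S` at the positions not divisible by `p = prm (h + 1)`, and whose bit at `q * p`, `q > 0`, is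
the parity of the bits at `q * prm k`, `k ∈ K` (the sum in `Bool` is exclusive or). -/
noncomputable def parityExtension (h : ℕ) (K : Finset ℕ) (hK : K ⊆ Finset.Icc 1 h)
    (S : ℕ → Bool) (n : ℕ) : Bool :=
  if _h0 : n = 0 then S 0
  else if _hr : n % prm (h + 1) = 0 then
    ∑ k : K, parityExtension h K hK S (n / prm (h + 1) * prm k)
  else S (n / prm (h + 1) * (prm (h + 1) - 1) + n % prm (h + 1))
termination_by n
decreasing_by
  have h1 := prm_lt (hK k.2)
  have h2 : n / prm (h + 1) * prm (h + 1) = n := Nat.div_mul_cancel (Nat.dvd_of_mod_eq_zero _hr)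
  have h3 : 0 < n / prm (h + 1) := by
    rcases Nat.eq_zero_or_pos (n / prm (h + 1)) with h4 | h4
    · rw [h4, zero_mul] at h2
      exact absurd h2.symm _h0
    · exact h4
  calc n / prm (h + 1) * prm k < n / prm (h + 1) * prm (h + 1) := Nat.mul_lt_mul_of_pos_left h1 h3
    _ = n := h2

theorem parityExtension_zero (h : ℕ) (K : Finset ℕ) (hK : K ⊆ Finset.Icc 1 h) (S : ℕ → Bool) :
    parityExtension h K hK S 0 = S 0 := by
  rw [parityExtension]
  simp

theorem parityExtension_mul (h : ℕ) (K : Finset ℕ) (hK : K ⊆ Finset.Icc 1 h) (S : ℕ → Bool)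
    (q : ℕ) (hq : q ≠ 0) :
    parityExtension h K hK S (q * prm (h + 1)) =
      ∑ k ∈ K, parityExtension h K hK S (q * prm k) := by
  have hp : 0 < prm (h + 1) := (Nat.prime_nth_prime h).pos
  rw [parityExtension]
  simp [hq, hp.ne', Nat.mul_div_cancel _ hp]
  exact Finset.sum_coe_sort K (fun k => parityExtension h K hK S (q * prm k))

theorem parityExtension_add (h : ℕ) (K : Finset ℕ) (hK : K ⊆ Finset.Icc 1 h) (S : ℕ → Bool)
    (q r : ℕ) (hr : 0 < r) (h2 : r < prm (h + 1)) :
    parityExtension h K hK S (q * prm (h + 1) + r) = S (q * (prm (h + 1) - 1) + r) := by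
  have hp : 0 < prm (h + 1) := (Nat.prime_nth_prime h).pos
  rw [parityExtension]
  have h1 : (q * prm (h + 1) + r) / prm (h + 1) = q := by
    rw [mul_comm, Nat.mul_add_div hp, Nat.div_eq_of_lt h2, add_zero]
  simp [hr.ne', h1, Nat.mod_eq_of_lt h2]

/-- The function `F'_{h+1}`, with parities over the first `h - 1` primes. -/
noncomputable def Fprime (h : ℕ) : (ℕ → Bool) → (ℕ → Bool) :=
  parityExtension h (Finset.Icc 1 (h - 1)) (Finset.Icc_subset_Icc_right (Nat.sub_le h 1))

/-- The function `F''_{h+1}`, with parities over the second to the `h`-th prime. -/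
noncomputable def Fdoubleprime (h : ℕ) : (ℕ → Bool) → (ℕ → Bool) :=
  parityExtension h (Finset.Icc 2 h) (Finset.Icc_subset_Icc_left one_le_two)

/-!
Each of the sequences `F'(S)`, `F''(S)` is predictable at the multiples of `p = prm (h + 1)`:
`h - 1` trailing heads of speeds `prm k / p` read the bits of the parity condition in time. So the
predimensions of the two families are at most `1 - 1 / p`. Together the two families ask for the `h`
speeds `prm 1 / p, …, prm h / p`, and a gambler has only `h - 1` trailing heads.

The lower bound must also exclude indirect predictions, since the bits of the parity conditions are
parities themselves. Code positions by monomials, through prime factorization; the parity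
condition then says that a certain linear form `∑ r ∈ I, X_r` acts as zero, where `I` is the set of
primes in the condition. Heads with speeds `v i` can predict bit `n` in the long run only if some
multiple of the linear form has all its monomials among `n` and the positions `v i * n`. Such a
multiple has at least as many monomials as the linear form
(`card_le_card_support_sumMultiples`), so that for `F'` all the heads are needed, and no speed has
`prm h` as a factor; but for `F''` a multiple of the linear form is not homogeneous in the variable
of `prm h` (`exists_factorization_ne`), so that some speed has this factor. Hence for one of the two
families no bit is predictable, which by duality means that each position `n` has a *toggle*: a
sequence that satisfies the parity condition, contains `n`, and avoids the positions `v i * n`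
(`exists_isToggle_or`).

Look at the windows `[k³, (k + 1)³)`. Their relative length tends to zero, and the betting state at
the start of a window takes finitely many values. For all `n` in the window, except for a small
proportion of `n` with high prime powers, adding the toggle of `n` to the sequence complements
bit `n` and changes no bit that a head has read in the window before. So bets are fair on average,
and by Markov's inequality the set of strings on which the gambler multiplies its capital
by `2 ^ (w / e)` in the window, `w` being the length of the window, has relative size at most
`2 ^ (-2 * k)` (`exists_forall_card_gainSet_le`). A sequence that avoids these sets from some `k` on
bounds the `s`-gale for `s < 1 - 1 / e` (`notMem_successSet_of_avoids`). For a given gambler such a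
sequence exists by compactness (`exists_avoids`), which suffices for instability, with the ranges
of `F'` and `F''` as the two sets. Martin-Löf random sequences have the property for all gamblers
at once: membership in the sets is decidable, so that a string in the `k`-th set has a description
that is shorter than the string by `k - 1` bits (`IsMartinLofRandom.avoids`).
-/

/-! ### Sums over the multiples of a set of primes -/

/-- Identify a finitely supported function on the positive integers with a polynomial over `𝔽₂`
through prime factorization (one variable for each prime). Multiplication by the linear form
`∑ r ∈ I, X_r` becomes this map, which sends the basis vector at `q` to the sum of the basis
vectors at `r * q`, `r ∈ I`. -/
noncomputable def sumMultiples (I : Finset ℕ) : (ℕ →₀ ZMod 2) →ₗ[ZMod 2] (ℕ →₀ ZMod 2) :=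
  ∑ r ∈ I, Finsupp.lmapDomain (ZMod 2) (ZMod 2) (fun q => r * q)

theorem sumMultiples_apply (I : Finset ℕ) (Q : ℕ →₀ ZMod 2) (m : ℕ) :
    sumMultiples I Q m = ∑ r ∈ I, Finsupp.mapDomain (fun q => r * q) Q m := by
  simp [sumMultiples, LinearMap.sum_apply, Finsupp.finsetSum_apply]

theorem sumMultiples_single (I : Finset ℕ) (q : ℕ) :
    sumMultiples I (Finsupp.single q 1) = ∑ r ∈ I, Finsupp.single (r * q) 1 := by
  simp [sumMultiples, LinearMap.sum_apply, Finsupp.mapDomain_single]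

theorem exists_mem_of_mapDomain_mul_ne_zero {r a : ℕ} {Q : ℕ →₀ ZMod 2}
    (h : Finsupp.mapDomain (fun q => r * q) Q a ≠ 0) : ∃ c ∈ Q.support, a = r * c := by
  have := Finsupp.mapDomain_support (Finsupp.mem_support_iff.2 h)
  obtain ⟨c, hc, rfl⟩ := Finset.mem_image.1 this
  exact ⟨c, hc, rfl⟩

/-- A monomial of maximal `X_r`-degree of the product of `Q` and the linear form: there the
`X_r`-degree is one more than the maximal `X_r`-degree in `Q`, and no other variable of the
linear form gets beyond its maximal degree in `Q`. -/
theorem exists_extreme_mem_support {I : Finset ℕ} (hI : ∀ r ∈ I, r.Prime) {Q : ℕ →₀ ZMod 2}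
    (hQ : Q ≠ 0) (hQ0 : ∀ q ∈ Q.support, q ≠ 0) {r : ℕ} (hr : r ∈ I) :
    ∃ a ∈ (sumMultiples I Q).support,
      a.factorization r = Q.support.sup (fun q => q.factorization r) + 1 ∧
      ∀ s ∈ I, s ≠ r → a.factorization s ≤ Q.support.sup (fun q => q.factorization s) := by
  obtain ⟨b, hb, hbmax⟩ := Finset.exists_mem_eq_sup Q.support
    (Finsupp.support_nonempty_iff.2 hQ) (fun q => q.factorization r)
  have hle : ∀ s, ∀ c ∈ Q.support, c.factorization s ≤
      Q.support.sup (fun q => q.factorization s) := fun s c hc =>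
    Finset.le_sup (f := fun q : ℕ => q.factorization s) hc
  have hfact : ∀ t ∈ I, ∀ c ∈ Q.support, ∀ s, (t * c).factorization s =
      (if t = s then 1 else 0) + c.factorization s := by
    intro t ht c hc s
    rw [Nat.factorization_mul (hI t ht).ne_zero (hQ0 c hc), (hI t ht).factorization]
    simp [Finsupp.single_apply]
  refine ⟨r * b, ?_, ?_, ?_⟩
  · rw [Finsupp.mem_support_iff, sumMultiples_apply, Finset.sum_eq_single r]
    · have hinj : Function.Injective (fun q => r * q) :=
        fun x y h => Nat.eq_of_mul_eq_mul_left (hI r hr).pos h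
      have := Finsupp.mapDomain_apply hinj Q b
      rw [this]
      exact Finsupp.mem_support_iff.1 hb
    · intro t ht htr
      by_contra h
      obtain ⟨c, hc, hce⟩ := exists_mem_of_mapDomain_mul_ne_zero h
      have h1 := hfact r hr b hb r
      have h2 := hfact t ht c hc r
      rw [← hce, h1, if_pos rfl, if_neg htr, ← hbmax] at h2
      have := hle r c hc
      omega
    · exact fun h => absurd hr h
  · rw [hfact r hr b hb, if_pos rfl, hbmax, add_comm]
  · intro s _ hsr
    rw [hfact r hr b hb, if_neg (Ne.symm hsr), zero_add]
    exact hle s b hb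

/-- A nonzero multiple of a linear form has at least as many monomials as the linear form. -/
theorem card_le_card_support_sumMultiples {I : Finset ℕ} (hI : ∀ r ∈ I, r.Prime)
    {Q : ℕ →₀ ZMod 2} (hQ : Q ≠ 0) (hQ0 : ∀ q ∈ Q.support, q ≠ 0) :
    I.card ≤ (sumMultiples I Q).support.card := by
  choose! a ha ha1 ha2 using fun r (hr : r ∈ I) => exists_extreme_mem_support hI hQ hQ0 hr
  refine Finset.card_le_card_of_injOn a (fun r hr => ha r hr) ?_
  intro r hr s hs hrs
  by_contra hne
  have h1 := ha1 r hr
  have h2 := ha2 s hs r hr hne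
  rw [← hrs] at h2
  omega

/-- A nonzero multiple of a linear form with at least two terms is not homogeneous in any of the
variables of that form. -/
theorem exists_factorization_ne {I : Finset ℕ} (hI : ∀ r ∈ I, r.Prime) {Q : ℕ →₀ ZMod 2}
    (hQ : Q ≠ 0) (hQ0 : ∀ q ∈ Q.support, q ≠ 0) {r s : ℕ} (hr : r ∈ I) (hs : s ∈ I)
    (hrs : r ≠ s) :
    ∃ a ∈ (sumMultiples I Q).support, ∃ b ∈ (sumMultiples I Q).support,
      a.factorization r ≠ b.factorization r := by
  obtain ⟨a, ha, ha1, -⟩ := exists_extreme_mem_support hI hQ hQ0 hr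
  obtain ⟨b, hb, -, hb2⟩ := exists_extreme_mem_support hI hQ hQ0 hs
  refine ⟨a, ha, b, hb, ?_⟩
  have := hb2 r hr hrs
  omega

/-- Either the value at `n` of a sequence with vanishing sums over multiples is independent of the
values on `S`, or there is a linear relation, that is a multiple of the linear form with
monomials in `S ∪ {n}`. -/
theorem exists_weight_or_exists_multiple (I : Finset ℕ) {S : Finset ℕ} {n : ℕ} (hn : n ∉ S) :
    (∃ Y : ℕ → ZMod 2, (∀ q, q ≠ 0 → ∑ r ∈ I, Y (r * q) = 0) ∧ Y n = 1 ∧ ∀ m ∈ S, Y m = 0) ∨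
    ∃ Q : ℕ →₀ ZMod 2, Q ≠ 0 ∧ (∀ q ∈ Q.support, q ≠ 0) ∧ n ∈ (sumMultiples I Q).support ∧
      (sumMultiples I Q).support ⊆ insert n S := by
  set V : Submodule (ZMod 2) (ℕ →₀ ZMod 2) := Finsupp.supported (ZMod 2) (ZMod 2) (S : Set ℕ) ⊔
    (Finsupp.supported (ZMod 2) (ZMod 2) {q : ℕ | q ≠ 0}).map (sumMultiples I) with hV
  by_cases hmem : Finsupp.single n (1 : ZMod 2) ∈ V
  · right
    obtain ⟨u, hu, v, hv, huv⟩ := Submodule.mem_sup.1 hmem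
    obtain ⟨Q, hQ, rfl⟩ := Submodule.mem_map.1 hv
    rw [Finsupp.mem_supported] at hu hQ
    have hP : sumMultiples I Q = Finsupp.single n 1 - u := by rw [← huv]; simp
    have hun : u n = 0 := by
      by_contra h
      exact hn (hu (Finsupp.mem_support_iff.2 h))
    have hPn : sumMultiples I Q n = 1 := by simp [hP, hun]
    refine ⟨Q, ?_, fun q hq => hQ hq, ?_, ?_⟩
    · rintro rfl
      simp at hPn
    · rw [Finsupp.mem_support_iff, hPn]
      exact one_ne_zero
    · intro m hm
      by_contra hmem
      rw [Finset.mem_insert, not_or] at hmem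
      rw [Finsupp.mem_support_iff, hP] at hm
      apply hm
      have : u m = 0 := by
        by_contra h
        exact hmem.2 (hu (Finsupp.mem_support_iff.2 h))
      simp [this, Ne.symm hmem.1]
  · left
    obtain ⟨f, hf, hVf⟩ := Submodule.exists_le_ker_of_notMem hmem
    refine ⟨fun m => f (Finsupp.single m 1), ?_, ?_, ?_⟩
    · intro q hq
      rw [← map_sum, ← sumMultiples_single]
      exact hVf (Submodule.mem_sup_right (Submodule.mem_map_of_mem
        (Finsupp.single_mem_supported _ _ hq)))
    · have hz : ∀ z : ZMod 2, z ≠ 0 → z = 1 := by decide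
      exact hz _ hf
    · intro m hm
      exact hVf (Submodule.mem_sup_left (Finsupp.single_mem_supported _ _ hm))

/-- The positive integer `m` is in the class of `n` if `m / n` is a quotient of two products of
equally many elements of `I`. A parity condition relates only members of the same class. -/
def SameClass (I : Finset ℕ) (m n : ℕ) : Prop :=
  m ≠ 0 ∧ (∀ r, r ∉ I → m.factorization r = n.factorization r) ∧
    ∑ r ∈ I, m.factorization r = ∑ r ∈ I, n.factorization r

theorem SameClass.refl (I : Finset ℕ) {n : ℕ} (hn : n ≠ 0) : SameClass I n n :=
  ⟨hn, fun _ _ => rfl, rfl⟩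

theorem sameClass_mul_iff {I : Finset ℕ} (hI : ∀ r ∈ I, r.Prime) {r s q n : ℕ} (hr : r ∈ I)
    (hs : s ∈ I) (hq : q ≠ 0) : SameClass I (r * q) n ↔ SameClass I (s * q) n := by
  suffices h : ∀ r ∈ I, SameClass I (r * q) n ↔
      (∀ t, t ∉ I → q.factorization t = n.factorization t) ∧
      1 + ∑ t ∈ I, q.factorization t = ∑ t ∈ I, n.factorization t by
    rw [h r hr, h s hs]
  intro r hr
  have hf : ∀ t, (r * q).factorization t = (if r = t then 1 else 0) + q.factorization t := by
    intro t
    rw [Nat.factorization_mul (hI r hr).ne_zero hq, (hI r hr).factorization]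
    simp [Finsupp.single_apply]
  have h1 : ∑ t ∈ I, (r * q).factorization t = 1 + ∑ t ∈ I, q.factorization t := by
    simp_rw [hf, Finset.sum_add_distrib]
    simp [hr]
  rw [SameClass, h1]
  constructor
  · rintro ⟨-, h2, h3⟩
    refine ⟨fun t ht => ?_, h3⟩
    rw [← h2 t ht, hf, if_neg (ne_of_mem_of_not_mem hr ht), zero_add]
  · rintro ⟨h2, h3⟩
    refine ⟨mul_ne_zero (hI r hr).ne_zero hq, fun t ht => ?_, h3⟩
    rw [← h2 t ht, hf, if_neg (ne_of_mem_of_not_mem hr ht), zero_add]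

/-- The ratios of the members of a class to a member without high powers of primes in `I` form a
finite set. -/
theorem SameClass.exists_mul_eq {I : Finset ℕ} (hI : ∀ r ∈ I, r.Prime) {A m n : ℕ} (hn : n ≠ 0)
    (h : SameClass I m n) (hA : ∀ r ∈ I, ¬ r ^ A ∣ n) :
    ∃ x y : ℕ, 0 < x ∧ 0 < y ∧ x ≤ ∏ r ∈ I, r ^ (I.card * A) ∧ y ≤ ∏ r ∈ I, r ^ (I.card * A) ∧
      y * m = x * n := by
  obtain ⟨hm, h1, h2⟩ := h
  have hlt : ∀ r ∈ I, n.factorization r ≤ A := by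
    intro r hr
    by_contra hlt
    exact hA r hr (((hI r hr).pow_dvd_iff_le_factorization hn).2 (by omega))
  have hsum : ∑ r ∈ I, n.factorization r ≤ I.card * A := by
    rw [← smul_eq_mul]
    exact Finset.sum_le_card_nsmul _ _ _ hlt
  have hbound : ∀ k : ℕ, (∑ r ∈ I, k.factorization r = ∑ r ∈ I, n.factorization r) →
      ∏ r ∈ I, r ^ k.factorization r ≤ ∏ r ∈ I, r ^ (I.card * A) := by
    intro k hk
    refine Finset.prod_le_prod' fun r hr => Nat.pow_le_pow_right (hI r hr).pos ?_
    refine le_trans ?_ (hk.trans_le hsum)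
    exact Finset.single_le_sum (f := fun r => k.factorization r) (fun _ _ => Nat.zero_le _) hr
  have hpos : ∀ k : ℕ, 0 < ∏ r ∈ I, r ^ k.factorization r := fun k =>
    Finset.prod_pos fun r hr => pow_pos (hI r hr).pos _
  refine ⟨∏ r ∈ I, r ^ m.factorization r, ∏ r ∈ I, r ^ n.factorization r, hpos m, hpos n,
    hbound m h2, hbound n rfl, ?_⟩
  have hfp : ∀ k t : ℕ, (∏ r ∈ I, r ^ k.factorization r).factorization t =
      if t ∈ I then k.factorization t else 0 := by
    intro k t
    rw [Nat.factorization_prod (fun r hr => (pow_pos (hI r hr).pos _).ne')]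
    rw [Finsupp.finsetSum_apply]
    rw [Finset.sum_congr rfl fun r hr => by
      rw [(hI r hr).factorization_pow, Finsupp.single_apply]]
    simp
  refine Nat.eq_of_factorization_eq (mul_ne_zero (hpos n).ne' hm) (mul_ne_zero (hpos m).ne' hn) ?_
  intro t
  rw [Nat.factorization_mul (hpos n).ne' hm, Nat.factorization_mul (hpos m).ne' hn]
  simp only [Finsupp.add_apply, hfp]
  split_ifs with ht
  · rw [add_comm]
  · rw [h1 t ht]

/-- A sequence `Y` with vanishing sums over multiples, which is `1` at `n`, lives on the class of
`n`, and vanishes on `S`. -/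
def IsToggle (I : Finset ℕ) (n : ℕ) (S : Set ℕ) (Y : ℕ → ZMod 2) : Prop :=
  (∀ q, q ≠ 0 → ∑ r ∈ I, Y (r * q) = 0) ∧ Y n = 1 ∧
    (∀ m, ¬ SameClass I m n → Y m = 0) ∧ ∀ m ∈ S, Y m = 0

theorem exists_isToggle_of_weight {I : Finset ℕ} (hI : ∀ r ∈ I, r.Prime) {n : ℕ} (hn : n ≠ 0)
    {S : Set ℕ} {Y : ℕ → ZMod 2} (hY : ∀ q, q ≠ 0 → ∑ r ∈ I, Y (r * q) = 0) (hYn : Y n = 1)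
    (hYS : ∀ m ∈ S, SameClass I m n → Y m = 0) : ∃ Y, IsToggle I n S Y := by
  classical
  refine ⟨fun m => if SameClass I m n then Y m else 0, ?_, ?_, ?_, ?_⟩
  · intro q hq
    by_cases h : ∃ r ∈ I, SameClass I (r * q) n
    · obtain ⟨r, hr, h⟩ := h
      refine (Finset.sum_congr rfl fun s hs => ?_).trans (hY q hq)
      simp only
      rw [if_pos ((sameClass_mul_iff hI hr hs hq).1 h)]
    · push Not at h
      exact Finset.sum_eq_zero fun r hr => if_neg (h r hr)
  · simp [SameClass.refl I hn, hYn]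
  · intro m hm
    simp [hm]
  · intro m hm
    by_cases h : SameClass I m n
    · simp [h, hYS m hm h]
    · simp [h]

/-- The positions of `d` heads of rational speeds `a i / b` at time `n`, when they are integers. -/
def speedPositions {d : ℕ} (b : ℕ) (a : Fin d → ℕ) (n : ℕ) : Set ℕ :=
  {m | m ≠ n ∧ ∃ i, b * m = a i * n}

/-- If `d` heads allow a linear relation for the prime set `I`, which has more than `d` elements, then
all the heads are needed for it. So no speed has a factor `s ∉ I`, and there is no linear relation
for a set of at least two primes that contains `s`. -/
theorem exists_isToggle_or {d : ℕ} {b : ℕ} (hb : 0 < b) (a : Fin d → ℕ) {I J : Finset ℕ}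
    (hI : ∀ r ∈ I, r.Prime) (hJ : ∀ r ∈ J, r.Prime) (hId : d < I.card)
    {s t : ℕ} (hsI : s ∉ I) (hsJ : s ∈ J) (htJ : t ∈ J) (hst : s ≠ t) :
    (∀ n, n ≠ 0 → ∃ Y, IsToggle I n (speedPositions b a n) Y) ∨
    (∀ n, n ≠ 0 → ∃ Y, IsToggle J n (speedPositions b a n) Y) := by
  classical
  rw [or_iff_not_imp_left]
  intro hnot
  push Not at hnot
  obtain ⟨n, hn, hnY⟩ := hnot
  -- The relation for `I` at `n` involves each head, so no speed has `s` as a factor.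
  have key : ∀ i, a i ≠ 0 ∧ (a i).factorization s = b.factorization s := by
    set T : Finset (Fin d) := Finset.univ.filter fun i => a i * n / b ≠ n ∧
      b * (a i * n / b) = a i * n ∧ SameClass I (a i * n / b) n with hT
    set S : Finset ℕ := T.image fun i => a i * n / b with hS
    have hnS : n ∉ S := by
      intro h
      obtain ⟨i, hi, hin⟩ := Finset.mem_image.1 h
      exact (Finset.mem_filter.1 hi).2.1 hin
    rcases exists_weight_or_exists_multiple I hnS with ⟨Y, h1, h2, h3⟩ | ⟨Q, hQ, hQ0, hnQ, hQS⟩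
    · obtain ⟨Y', hY'⟩ := exists_isToggle_of_weight hI hn (S := speedPositions b a n) h1 h2 (by
        rintro m ⟨hmn, i, hi⟩ hm
        refine h3 m (Finset.mem_image.2 ⟨i, ?_, ?_⟩)
        · have : a i * n / b = m := by rw [← hi, Nat.mul_div_cancel_left _ hb]
          simp [hT, this, hmn, hi, hm]
        · rw [← hi, Nat.mul_div_cancel_left _ hb])
      exact absurd hY' (hnY Y')
    · have h1 := card_le_card_support_sumMultiples hI hQ hQ0
      have h2 := (Finset.card_le_card hQS).trans (Finset.card_insert_le n S)
      have h3 : S.card ≤ T.card := Finset.card_image_le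
      have h4 : T = Finset.univ := by
        rw [← Finset.card_eq_iff_eq_univ, Fintype.card_fin]
        have : T.card ≤ d := (Finset.card_le_univ T).trans_eq (Fintype.card_fin d)
        omega
      intro i
      have hi : i ∈ T := h4 ▸ Finset.mem_univ i
      obtain ⟨-, -, hbi, hm, hf, -⟩ := Finset.mem_filter.1 hi
      have hai : a i ≠ 0 := by
        rintro h
        apply hm
        simp [h]
      refine ⟨hai, ?_⟩
      have := congrArg (fun k => Nat.factorization k s) hbi
      rw [Nat.factorization_mul hb.ne' hm, Nat.factorization_mul hai hn, Finsupp.add_apply,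
        Finsupp.add_apply, hf s hsI] at this
      omega
  intro n hn
  set S : Finset ℕ := (Finset.univ.image fun i => a i * n / b).filter
    fun m => m ≠ n ∧ ∃ i, b * m = a i * n with hS
  have hSmem : ∀ m, m ∈ S ↔ m ≠ n ∧ ∃ i, b * m = a i * n := by
    intro m
    rw [hS, Finset.mem_filter, and_iff_right_iff_imp]
    rintro ⟨-, i, hi⟩
    exact Finset.mem_image.2 ⟨i, Finset.mem_univ i, by rw [← hi, Nat.mul_div_cancel_left _ hb]⟩
  have hnS : n ∉ S := fun h => ((hSmem n).1 h).1 rfl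
  rcases exists_weight_or_exists_multiple J hnS with ⟨Y, h1, h2, h3⟩ | ⟨Q, hQ, hQ0, hnQ, hQS⟩
  · exact exists_isToggle_of_weight hJ hn h1 h2 fun m hm _ => h3 m ((hSmem m).2 hm)
  · exfalso
    have hall : ∀ m ∈ (sumMultiples J Q).support, m.factorization s = n.factorization s := by
      intro m hm
      rcases Finset.mem_insert.1 (hQS hm) with rfl | hmS
      · rfl
      · obtain ⟨-, i, hi⟩ := (hSmem m).1 hmS
        have hm0 : m ≠ 0 := by
          rintro rfl
          rw [mul_zero] at hi
          exact mul_ne_zero (key i).1 hn hi.symm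
        have := congrArg (fun k => Nat.factorization k s) hi
        rw [Nat.factorization_mul hb.ne' hm0, Nat.factorization_mul (key i).1 hn,
          Finsupp.add_apply, Finsupp.add_apply, (key i).2] at this
        omega
    obtain ⟨x, hx, y, hy, hxy⟩ := exists_factorization_ne hJ hQ hQ0 hsJ htJ hst
    exact hxy ((hall x hx).trans (hall y hy).symm)

/-! ### The parity extension as a linear map -/

theorem prime_prm (i : ℕ) : (prm i).Prime := Nat.prime_nth_prime (i - 1)

theorem prm_injOn : Set.InjOn prm {i | 1 ≤ i} := by
  intro i hi j hj h
  have := (Nat.nth_strictMono Nat.infinite_setOfPred_prime).injective h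
  simp only [Set.mem_ofPred_eq] at hi hj
  omega

/-- The induction principle that follows the recursion of `parityExtension`. -/
theorem parity_induction {h : ℕ} {K : Finset ℕ} (hK : K ⊆ Finset.Icc 1 h) {P : ℕ → Prop}
    (zero : P 0)
    (mul : ∀ q, q ≠ 0 → (∀ k ∈ K, P (q * prm k)) → P (q * prm (h + 1)))
    (add : ∀ q r, 0 < r → r < prm (h + 1) → P (q * prm (h + 1) + r)) (n : ℕ) : P n := by
  induction n using Nat.strong_induction_on with
  | _ n ih =>
    have hp := (prime_prm (h + 1)).pos
    have hdiv := Nat.div_add_mod' n (prm (h + 1))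
    rcases Nat.eq_zero_or_pos (n % prm (h + 1)) with hr | hr
    · rw [hr, add_zero] at hdiv
      rcases Nat.eq_zero_or_pos (n / prm (h + 1)) with hq | hq
      · rw [hq, zero_mul] at hdiv
        exact hdiv ▸ zero
      · have := mul _ hq.ne' fun k hk => ih _ <| by
          calc _ < n / prm (h + 1) * prm (h + 1) := Nat.mul_lt_mul_of_pos_left (prm_lt (hK hk)) hq
            _ = n := hdiv
        rwa [hdiv] at this
    · have := add (n / prm (h + 1)) _ hr (Nat.mod_lt _ hp)
      rwa [hdiv] at this

theorem parityExtension_congr {h : ℕ} {K : Finset ℕ} (hK : K ⊆ Finset.Icc 1 h) {S S' : ℕ → Bool}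
    (n : ℕ) (hS : ∀ j ≤ n, S j = S' j) :
    parityExtension h K hK S n = parityExtension h K hK S' n := by
  induction n using parity_induction hK with
  | zero => simp [parityExtension_zero, hS]
  | mul q hq ih =>
    rw [parityExtension_mul h K hK S q hq, parityExtension_mul h K hK S' q hq]
    refine Finset.sum_congr rfl fun k hk => ih k hk fun j hj => hS j (hj.trans ?_)
    exact Nat.mul_le_mul_left q (prm_lt (hK hk)).le
  | add q r hr hrp =>
    rw [parityExtension_add h K hK S q r hr hrp, parityExtension_add h K hK S' q r hr hrp]
    exact hS _ (Nat.add_le_add_right (Nat.mul_le_mul_left q (Nat.sub_le _ _)) r)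

theorem parityExtension_add_apply {h : ℕ} {K : Finset ℕ} (hK : K ⊆ Finset.Icc 1 h)
    (S S' : ℕ → Bool) (n : ℕ) :
    parityExtension h K hK (S + S') n =
      parityExtension h K hK S n + parityExtension h K hK S' n := by
  induction n using parity_induction hK with
  | zero => simp [parityExtension_zero]
  | mul q hq ih =>
    rw [parityExtension_mul h K hK _ q hq, parityExtension_mul h K hK S q hq,
      parityExtension_mul h K hK S' q hq, ← Finset.sum_add_distrib]
    exact Finset.sum_congr rfl fun k hk => ih k hk
  | add q r hr hrp =>
    rw [parityExtension_add h K hK _ q r hr hrp, parityExtension_add h K hK S q r hr hrp,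
      parityExtension_add h K hK S' q r hr hrp, Pi.add_apply]

/-- Each sequence with the parity property is the extension of the subsequence of its new bits. -/
theorem exists_parityExtension_eq {h : ℕ} {K : Finset ℕ} (hK : K ⊆ Finset.Icc 1 h) {Y : ℕ → Bool}
    (hY : ∀ q, q ≠ 0 → Y (q * prm (h + 1)) = ∑ k ∈ K, Y (q * prm k)) :
    ∃ S, ∀ n, parityExtension h K hK S n = Y n := by
  refine ⟨fun j => if j = 0 then Y 0 else Y (j + (j - 1) / (prm (h + 1) - 1)), fun n => ?_⟩
  induction n using parity_induction hK with
  | zero => simp [parityExtension_zero]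
  | mul q hq ih =>
    rw [parityExtension_mul h K hK _ q hq, hY q hq]
    exact Finset.sum_congr rfl fun k hk => ih k hk
  | add q r hr hrp =>
    rw [parityExtension_add h K hK _ q r hr hrp, if_neg (by omega)]
    obtain ⟨c, hc⟩ : ∃ c, prm (h + 1) = c + 1 := ⟨_, (Nat.succ_pred_prime (prime_prm _)).symm⟩
    rw [hc] at hrp ⊢
    have : (q * (c + 1 - 1) + r - 1) / (c + 1 - 1) = q := by
      rw [Nat.add_sub_cancel, Nat.add_sub_assoc hr, mul_comm, Nat.mul_add_div (by omega),
        Nat.div_eq_of_lt (by omega), add_zero]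
    rw [this]
    congr 1
    rw [Nat.add_sub_cancel]
    ring

/-- The primes that occur in a parity condition: `prm k` for `k ∈ K`, and `prm (h + 1)`. -/
noncomputable def parityPrimes (h : ℕ) (K : Finset ℕ) : Finset ℕ :=
  insert (prm (h + 1)) (K.image prm)

theorem prime_of_mem_parityPrimes {h : ℕ} {K : Finset ℕ} : ∀ r ∈ parityPrimes h K, r.Prime := by
  intro r hr
  rcases Finset.mem_insert.1 hr with rfl | hr
  · exact prime_prm _
  · obtain ⟨k, -, rfl⟩ := Finset.mem_image.1 hr
    exact prime_prm k

theorem injOn_prm_of_subset {h : ℕ} {K : Finset ℕ} (hK : K ⊆ Finset.Icc 1 h) :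
    Set.InjOn prm (K : Set ℕ) :=
  prm_injOn.mono fun _ hk => (Finset.mem_Icc.1 (hK hk)).1

theorem prm_notMem_parityPrimes {h : ℕ} {K : Finset ℕ} (hK : K ⊆ Finset.Icc 1 h) {i : ℕ}
    (hi : 1 ≤ i) (hih : i ≠ h + 1) (hiK : i ∉ K) : prm i ∉ parityPrimes h K := by
  intro hmem
  rcases Finset.mem_insert.1 hmem with he | he
  · exact hih (prm_injOn hi (by simp) he)
  · obtain ⟨k, hk, hki⟩ := Finset.mem_image.1 he
    exact hiK ((prm_injOn (Finset.mem_Icc.1 (hK hk)).1 hi hki) ▸ hk)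

theorem prm_succ_notMem_image {h : ℕ} {K : Finset ℕ} (hK : K ⊆ Finset.Icc 1 h) :
    prm (h + 1) ∉ K.image prm := by
  intro hmem
  obtain ⟨k, hk, hkh⟩ := Finset.mem_image.1 hmem
  exact (prm_lt (hK hk)).ne hkh

theorem card_parityPrimes {h : ℕ} {K : Finset ℕ} (hK : K ⊆ Finset.Icc 1 h) :
    (parityPrimes h K).card = K.card + 1 := by
  rw [parityPrimes, Finset.card_insert_of_notMem (prm_succ_notMem_image hK),
    Finset.card_image_of_injOn (injOn_prm_of_subset hK)]

/-- The sequence of binary digits of a natural number, which codes a finite string. -/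
def bits (m : ℕ) : ℕ → Bool := fun i => m.testBit i

theorem bits_xor (m n : ℕ) : bits (m ^^^ n) = bits m + bits n := by
  funext i
  simp only [bits, Nat.testBit_xor, Pi.add_apply]
  rfl

theorem exists_bits_eq (S : ℕ → Bool) (N : ℕ) : ∃ m < 2 ^ N, ∀ i < N, bits m i = S i :=
  ⟨Nat.ofBits fun i : Fin N => S i, Nat.ofBits_lt_two_pow _,
    fun i hi => Nat.testBit_ofBits_lt _ i hi⟩

/-- A toggle for the primes of the parity condition gives a change of the input string that
complements the output bit at `n` and keeps the other output bits, except at the positions in the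
class of `n` and outside `S`. -/
theorem IsToggle.exists_xor {h : ℕ} {K : Finset ℕ} (hK : K ⊆ Finset.Icc 1 h) {n N : ℕ}
    {S : Set ℕ} {Y : ℕ → ZMod 2} (hY : IsToggle (parityPrimes h K) n S Y) (hnN : n < N) :
    ∃ ρ < 2 ^ N, ∀ m,
      parityExtension h K hK (bits (m ^^^ ρ)) n = !parityExtension h K hK (bits m) n ∧
      ∀ j < N, (SameClass (parityPrimes h K) j n → j ∈ S) →
        parityExtension h K hK (bits (m ^^^ ρ)) j = parityExtension h K hK (bits m) j := by
  obtain ⟨hbal, hn, hclass, hS⟩ := hY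
  let f : ZMod 2 →+ Bool :=
    { toFun := fun z => decide (z = 1)
      map_zero' := by decide
      map_add' := by decide }
  obtain ⟨T, hT⟩ := exists_parityExtension_eq hK (Y := fun m => f (Y m)) (by
    intro q hq
    have h1 := hbal q hq
    rw [parityPrimes, Finset.sum_insert (prm_succ_notMem_image hK),
      Finset.sum_image (injOn_prm_of_subset hK)] at h1
    have hneg : ∀ x y : ZMod 2, x + y = 0 → x = y := by decide
    rw [mul_comm, hneg _ _ h1, map_sum]
    exact Finset.sum_congr rfl fun k _ => by rw [mul_comm])
  obtain ⟨ρ, hρ, hρT⟩ := exists_bits_eq T N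
  have hval : ∀ m, ∀ j < N, parityExtension h K hK (bits (m ^^^ ρ)) j =
      parityExtension h K hK (bits m) j + f (Y j) := by
    intro m j hj
    rw [bits_xor, parityExtension_add_apply, ← hT j,
      parityExtension_congr hK (S := bits ρ) (S' := T) j fun i hi => hρT i (hi.trans_lt hj)]
  refine ⟨ρ, hρ, fun m => ⟨?_, fun j hj hjS => ?_⟩⟩
  · rw [hval m n hnN, hn]
    exact Bool.xor_true _
  · have : Y j = 0 := by
      by_cases hc : SameClass (parityPrimes h K) j n
      · exact hS j (hjS hc)
      · exact hclass j hc
    rw [hval m j hj, this, map_zero, add_zero]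

/-! ### Head speeds and runs over a window -/

namespace MultiheadFSG

variable {h : ℕ}

/-- The movement is eventually periodic, so each head has a rational speed, up to a bounded
deviation of its position. -/
theorem exists_speed (G : MultiheadFSG h Bool) :
    ∃ (b : ℕ) (a : Fin (h - 1) → ℕ) (C : ℕ), 0 < b ∧
      ∀ n i, b * G.pos n i ≤ a i * n + C ∧ a i * n ≤ b * G.pos n i + C := by
  have := G.finite_T
  obtain ⟨n₁, n₂, hlt, heq⟩ : ∃ n₁ n₂, n₁ < n₂ ∧ G.δT^[n₁] G.t₀ = G.δT^[n₂] G.t₀ := by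
    obtain ⟨x, y, hxy, he⟩ := Finite.exists_ne_map_eq_of_infinite fun n : ℕ => G.δT^[n] G.t₀
    rcases lt_or_gt_of_ne hxy with h | h
    · exact ⟨x, y, h, he⟩
    · exact ⟨y, x, h, he.symm⟩
  obtain ⟨b, rfl⟩ := Nat.exists_eq_add_of_lt hlt
  have hper : ∀ j, G.δT^[n₁ + j + (b + 1)] G.t₀ = G.δT^[n₁ + j] G.t₀ := by
    intro j
    rw [show n₁ + j + (b + 1) = j + (n₁ + b + 1) by ring, Function.iterate_add_apply, ← heq,
      ← Function.iterate_add_apply, add_comm]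
  have hmono : ∀ n j i, G.pos n i ≤ G.pos (n + j) i := by
    intro n j i
    induction j with
    | zero => exact le_rfl
    | succ j ih => exact ih.trans (Nat.le_add_right _ _)
  set a : Fin (h - 1) → ℕ := fun i => G.pos (n₁ + (b + 1)) i - G.pos n₁ i with ha
  have hshift : ∀ j i, G.pos (n₁ + j + (b + 1)) i = G.pos (n₁ + j) i + a i := by
    intro j i
    induction j with
    | zero =>
      have := hmono n₁ (b + 1) i
      simp only [ha, add_zero]
      omega
    | succ j ih =>
      have hsucc : ∀ n, G.pos (n + 1) i = G.pos n i + (G.μ (G.δT^[n] G.t₀) i).toNat :=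
        fun _ => rfl
      rw [show n₁ + (j + 1) + (b + 1) = n₁ + j + (b + 1) + 1 by ring, hsucc, ih, hper,
        ← add_assoc n₁ j 1, hsucc]
      ring
  refine ⟨b + 1, a, (b + 1 + ∑ i, a i) * (n₁ + (b + 1)), Nat.succ_pos b, fun n i => ?_⟩
  have hai : a i ≤ ∑ i, a i := Finset.single_le_sum (fun _ _ => Nat.zero_le _) (Finset.mem_univ i)
  induction n using Nat.strong_induction_on with
  | _ n ih =>
    by_cases hn : n < n₁ + (b + 1)
    · have h1 := G.pos_le n i
      constructor
      · calc (b + 1) * G.pos n i ≤ (b + 1 + ∑ i, a i) * (n₁ + (b + 1)) :=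
            Nat.mul_le_mul (Nat.le_add_right _ _) (h1.trans hn.le)
          _ ≤ _ := Nat.le_add_left _ _
      · calc a i * n ≤ (b + 1 + ∑ i, a i) * (n₁ + (b + 1)) :=
            Nat.mul_le_mul (hai.trans (Nat.le_add_left _ _)) hn.le
          _ ≤ _ := Nat.le_add_left _ _
    · obtain ⟨j, rfl⟩ : ∃ j, n = n₁ + j + (b + 1) := ⟨n - n₁ - (b + 1), by omega⟩
      have := ih (n₁ + j) (by omega)
      rw [hshift, mul_add, mul_add, mul_comm (a i) (b + 1)]
      omega

/-- The betting state after `j` steps from time `N` in state `q`, on the sequence `X`. -/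
def betState (G : MultiheadFSG h Bool) (X : ℕ → Bool) (N : ℕ) (q : G.Q) : ℕ → G.Q
  | 0 => q
  | j + 1 => G.δQ (G.betState X N q j) (fun i => X (G.pos (N + j) i)) (X (N + j))

/-- The factor by which the capital grows in `j` steps from time `N` in state `q`, on `X`. -/
def gain (G : MultiheadFSG h Bool) (X : ℕ → Bool) (N : ℕ) (q : G.Q) : ℕ → ℚ≥0
  | 0 => 1
  | j + 1 => G.gain X N q j * (2 * G.β (G.betState X N q j) (X (N + j)))

theorem state_add (G : MultiheadFSG h Bool) (X : ℕ → Bool) (N j : ℕ) :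
    (G.state (N + j) fun i => X i).2 = G.betState X N (G.state N fun i => X i).2 j := by
  induction j with
  | zero => rfl
  | succ j ih =>
    rw [betState, ← ih]
    rfl

theorem martingale_add (G : MultiheadFSG h Bool) (X : ℕ → Bool) (N j : ℕ) :
    G.martingale (N + j) (fun i => X i) =
      G.martingale N (fun i => X i) * (G.gain X N (G.state N fun i => X i).2 j : ℝ≥0) := by
  induction j with
  | zero => simp [gain]
  | succ j ih =>
    have : G.martingale (N + (j + 1)) (fun i => X i) =
      (Fintype.card Bool : ℝ≥0) * G.martingale (N + j) (fun i => X i) *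
      (G.β (G.state (N + j) fun i => X i).2 (X (N + j)) : ℝ≥0) := rfl
    rw [this, ih, gain, ← state_add]
    push_cast
    rw [Fintype.card_bool]
    push_cast
    ring

theorem β_add_β_not (G : MultiheadFSG h Bool) (q : G.Q) (x : Bool) :
    G.β q x + G.β q (!x) = 1 := by
  rw [← G.sum_β q]
  cases x <;> simp [add_comm]

theorem β_le_one (G : MultiheadFSG h Bool) (q : G.Q) (x : Bool) : G.β q x ≤ 1 := by
  rw [← G.β_add_β_not q x]
  exact le_self_add

theorem gain_le (G : MultiheadFSG h Bool) (X : ℕ → Bool) (N : ℕ) (q : G.Q) (j : ℕ) :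
    G.gain X N q j ≤ 2 ^ j := by
  induction j with
  | zero => simp [gain]
  | succ j ih =>
    rw [gain, pow_succ]
    refine mul_le_mul' ih ?_
    calc _ ≤ 2 * (1 : ℚ≥0) := mul_le_mul_right (G.β_le_one _ _) 2
      _ = 2 := mul_one 2

/-- A run depends only on the bits under the heads. -/
theorem run_congr (G : MultiheadFSG h Bool) {X X' : ℕ → Bool} {N : ℕ} (q : G.Q) {j : ℕ}
    (hlead : ∀ t < j, X (N + t) = X' (N + t))
    (htrail : ∀ t < j, ∀ i, X (G.pos (N + t) i) = X' (G.pos (N + t) i)) :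
    G.betState X N q j = G.betState X' N q j ∧ G.gain X N q j = G.gain X' N q j := by
  induction j with
  | zero => exact ⟨rfl, rfl⟩
  | succ j ih =>
    obtain ⟨h1, h2⟩ := ih (fun t ht => hlead t (by omega)) fun t ht => htrail t (by omega)
    have h3 := hlead j (by omega)
    have h4 : (fun i => X (G.pos (N + j) i)) = fun i => X' (G.pos (N + j) i) :=
      funext fun i => htrail j (by omega) i
    simp only [betState, gain, h1, h2, h3, h4, and_self]

end MultiheadFSG

/-! ### Counting the sequences on which a gambler gains -/

theorem sum_xor {M : Type*} [AddCommMonoid M] {N ρ : ℕ} (hρ : ρ < 2 ^ N) (f : ℕ → M) :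
    ∑ m ∈ Finset.range (2 ^ N), f (m ^^^ ρ) = ∑ m ∈ Finset.range (2 ^ N), f m := by
  have hmem : ∀ m ∈ Finset.range (2 ^ N), m ^^^ ρ ∈ Finset.range (2 ^ N) := fun m hm =>
    Finset.mem_range.2 (Nat.xor_lt_two_pow (Finset.mem_range.1 hm) hρ)
  exact Finset.sum_nbij' (· ^^^ ρ) (· ^^^ ρ) hmem hmem (fun m _ => by simp)
    (fun m _ => by simp) fun m _ => rfl

/-- If `X` depends on `m` in such a way that some change of `m` complements the next bit and keeps
the bits read so far, then the next bet is fair on average. -/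
theorem sum_gain_succ_eq {h : ℕ} (G : MultiheadFSG h Bool) (X : ℕ → ℕ → Bool) {N M ρ j : ℕ}
    (q : G.Q) (hρ : ρ < 2 ^ M) (hnext : ∀ m, X (m ^^^ ρ) (N + j) = !X m (N + j))
    (hlead : ∀ m, ∀ t < j, X (m ^^^ ρ) (N + t) = X m (N + t))
    (htrail : ∀ m, ∀ t < j, ∀ i, X (m ^^^ ρ) (G.pos (N + t) i) = X m (G.pos (N + t) i)) :
    ∑ m ∈ Finset.range (2 ^ M), G.gain (X m) N q (j + 1) =
      ∑ m ∈ Finset.range (2 ^ M), G.gain (X m) N q j := by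
  have h2 : (2 : ℚ≥0) * ∑ m ∈ Finset.range (2 ^ M), G.gain (X m) N q (j + 1) =
      2 * ∑ m ∈ Finset.range (2 ^ M), G.gain (X m) N q j := by
    rw [two_mul]
    nth_rewrite 1 [← sum_xor hρ]
    rw [← Finset.sum_add_distrib, Finset.mul_sum]
    refine Finset.sum_congr rfl fun m _ => ?_
    obtain ⟨h3, h4⟩ := G.run_congr q (hlead m) (htrail m)
    rw [MultiheadFSG.gain, MultiheadFSG.gain, h3, h4, hnext m, ← mul_add, ← mul_add, add_comm,
      G.β_add_β_not, mul_one, mul_comm]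
  exact mul_left_cancel₀ two_ne_zero h2

theorem sum_gain_succ_le {h : ℕ} (G : MultiheadFSG h Bool) (X : ℕ → ℕ → Bool) (N M j : ℕ)
    (q : G.Q) :
    ∑ m ∈ Finset.range (2 ^ M), G.gain (X m) N q (j + 1) ≤
      2 * ∑ m ∈ Finset.range (2 ^ M), G.gain (X m) N q j := by
  rw [Finset.mul_sum]
  refine Finset.sum_le_sum fun m _ => ?_
  rw [MultiheadFSG.gain, mul_comm 2 (G.gain _ _ _ _)]
  have hβ : 2 * G.β (G.betState (X m) N q j) (X m (N + j)) ≤ 2 * 1 :=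
    mul_le_mul_right (G.β_le_one _ _) 2
  rw [mul_one] at hβ
  exact mul_le_mul_right hβ _

theorem card_filter_dvd_Ico_le {r : ℕ} (hr : 0 < r) (N w : ℕ) :
    ((Finset.Ico N (N + w)).filter (r ∣ ·)).card ≤ w / r + 2 := by
  calc _ ≤ (Finset.Icc (N / r) ((N + w) / r)).card := by
        refine Finset.card_le_card_of_injOn (· / r) ?_ ?_
        · intro n hn
          obtain ⟨hn, -⟩ := Finset.mem_filter.1 hn
          rw [Finset.mem_Ico] at hn
          exact Finset.mem_coe.2 (Finset.mem_Icc.2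
            ⟨Nat.div_le_div_right hn.1, Nat.div_le_div_right hn.2.le⟩)
        · intro x hx y hy hxy
          exact Nat.div_left_inj (Finset.mem_filter.1 hx).2 (Finset.mem_filter.1 hy).2 |>.1 hxy
    _ ≤ _ := by
        rw [Nat.card_Icc, Nat.add_div hr]
        generalize N / r = x, w / r = y
        split_ifs <;> omega

theorem card_filter_exists_pow_dvd_le {I : Finset ℕ} (hI : ∀ r ∈ I, r.Prime) (A N w : ℕ) :
    ((Finset.Ico N (N + w)).filter fun n => ∃ r ∈ I, r ^ A ∣ n).card ≤
      I.card * (w / 2 ^ A + 2) := by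
  classical
  calc _ ≤ (I.biUnion fun r => (Finset.Ico N (N + w)).filter (r ^ A ∣ ·)).card := by
        refine Finset.card_le_card fun n hn => ?_
        obtain ⟨hn, r, hr, hrn⟩ := Finset.mem_filter.1 hn
        exact Finset.mem_biUnion.2 ⟨r, hr, Finset.mem_filter.2 ⟨hn, hrn⟩⟩
    _ ≤ I.card * (w / 2 ^ A + 2) := by
        refine Finset.card_biUnion_le_card_mul _ _ _ fun r hr => ?_
        refine (card_filter_dvd_Ico_le (pow_pos (hI r hr).pos A) N w).trans ?_
        gcongr
        exact (hI r hr).two_le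

/-- In a window `[k³, (k + 1)³)` with `k` large, the members of the class of `n` that the heads read
are where the exact speeds put the heads at time `n`: the relative length of the window tends to
zero, and there are finitely many ratios in the class. -/
theorem sameClass_pos {h : ℕ} (G : MultiheadFSG h Bool) {b C : ℕ} {a : Fin (h - 1) → ℕ}
    (hpos : ∀ n i, b * G.pos n i ≤ a i * n + C ∧ a i * n ≤ b * G.pos n i + C)
    {I : Finset ℕ} (hI : ∀ r ∈ I, r.Prime) (A : ℕ) :
    ∃ k₀, ∀ k, k₀ ≤ k → ∀ n t, k ^ 3 ≤ t → t < n → n < (k + 1) ^ 3 → (∀ r ∈ I, ¬ r ^ A ∣ n) →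
      ¬ SameClass I t n ∧
      ∀ i, SameClass I (G.pos t i) n → G.pos t i ∈ speedPositions b a n := by
  set B := ∏ r ∈ I, r ^ (I.card * A) with hB
  set s := ∑ i, a i with hs
  refine ⟨1 + C * B + 7 * (s + 1) * B, fun k hk n t hkt htn hnk hA => ?_⟩
  have hn : n ≠ 0 := by omega
  have hk1 : 1 ≤ k := by omega
  have hw : n ≤ t + 7 * k ^ 2 := by nlinarith
  have hkn : k * k ^ 2 ≤ n := by nlinarith
  have hk2 : 1 ≤ k ^ 2 := Nat.one_le_pow _ _ hk1
  have hlarge : C * B + 7 * (s + 1) * B * k ^ 2 < n := by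
    calc C * B + 7 * (s + 1) * B * k ^ 2 < (1 + C * B + 7 * (s + 1) * B) * k ^ 2 := by
          nlinarith [Nat.mul_le_mul_left (C * B) hk2]
      _ ≤ k * k ^ 2 := Nat.mul_le_mul_right _ hk
      _ ≤ n := hkn
  constructor
  -- The ratio `t / n = x / y` with `y ≤ B` is less than `1`, but too close to `1`.
  · intro hc
    obtain ⟨x, y, hx, hy, hxB, hyB, hxy⟩ := hc.exists_mul_eq hI hn hA
    have hlt : x < y := by
      by_contra hle
      have := Nat.mul_le_mul (not_lt.1 hle) htn.le
      nlinarith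
    have h1 : y * n ≤ y * t + y * (7 * k ^ 2) := by
      rw [← mul_add]
      exact Nat.mul_le_mul_left y hw
    have h2 : (x + 1) * n ≤ y * n := Nat.mul_le_mul_right n hlt
    have h3 : y * (7 * k ^ 2) ≤ B * (7 * k ^ 2) := Nat.mul_le_mul_right _ hyB
    nlinarith [Nat.zero_le (s * B * k ^ 2), Nat.zero_le (C * B)]
  · intro i hc
    refine ⟨(Nat.lt_of_le_of_lt (G.pos_le t i) htn).ne, i, ?_⟩
    obtain ⟨x, y, hx, hy, hxB, hyB, hxy⟩ := hc.exists_mul_eq hI hn hA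
    obtain ⟨h1, h2⟩ := hpos t i
    set m := G.pos t i
    have has : a i ≤ s := Finset.single_le_sum (fun _ _ => Nat.zero_le _) (Finset.mem_univ i)
    have h3 : y * C ≤ C * B := by nlinarith
    have h4 : y * (b * m) = b * x * n := by rw [mul_left_comm, hxy, mul_assoc]
    -- The ratio `x / y` of the position to `n` is close to the speed `a i / b`. As both have bounded
    -- denominators, they are equal.
    have key : b * x = a i * y := by
      rcases lt_trichotomy (b * x) (a i * y) with hlt | heq | hlt
      · exfalso
        have h5 : (b * x + 1) * n ≤ a i * y * n := Nat.mul_le_mul_right n hlt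
        have h6 : a i * y * n ≤ a i * y * t + a i * y * (7 * k ^ 2) := by
          rw [← mul_add]
          exact Nat.mul_le_mul_left _ hw
        have h7 : y * (a i * t) ≤ y * (b * m) + y * C := by
          rw [← mul_add]
          exact Nat.mul_le_mul_left y h2
        have h8 : a i * y * (7 * k ^ 2) ≤ s * B * (7 * k ^ 2) :=
          Nat.mul_le_mul_right _ (Nat.mul_le_mul has hyB)
        nlinarith [Nat.zero_le (B * k ^ 2)]
      · exact heq
      · exfalso
        have h5 : (a i * y + 1) * n ≤ b * x * n := Nat.mul_le_mul_right n hlt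
        have h6 : a i * y * t ≤ a i * y * n := Nat.mul_le_mul_left _ htn.le
        have h7 : y * (b * m) ≤ y * (a i * t) + y * C := by
          rw [← mul_add]
          exact Nat.mul_le_mul_left y h1
        nlinarith [Nat.zero_le ((s + 1) * B * k ^ 2)]
    have : y * (b * m) = y * (a i * n) := by
      rw [h4, key]
      ring
    exact Nat.eq_of_mul_eq_mul_left hy this

/-- The (codes of) strings of length `(k + 1) ^ 3` whose parity extension lets the gambler, started
in some betting state, multiply its capital by `2 ^ (w / e)` in the window from `k ^ 3` to
`(k + 1) ^ 3`, which has length `w`. -/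
noncomputable def gainSet {h : ℕ} (G : MultiheadFSG h Bool) {K : Finset ℕ}
    (hK : K ⊆ Finset.Icc 1 h) (e k : ℕ) : Finset ℕ :=
  haveI : DecidablePred fun m => ∃ q : G.Q, 2 ^ (((k + 1) ^ 3 - k ^ 3) / e) ≤
      G.gain (parityExtension h K hK (bits m)) (k ^ 3) q ((k + 1) ^ 3 - k ^ 3) :=
    Classical.decPred _
  (Finset.range (2 ^ (k + 1) ^ 3)).filter fun m => ∃ q : G.Q,
    2 ^ (((k + 1) ^ 3 - k ^ 3) / e) ≤
      G.gain (parityExtension h K hK (bits m)) (k ^ 3) q ((k + 1) ^ 3 - k ^ 3)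

theorem mem_gainSet {h : ℕ} {G : MultiheadFSG h Bool} {K : Finset ℕ}
    {hK : K ⊆ Finset.Icc 1 h} {e k m : ℕ} :
    m ∈ gainSet G hK e k ↔ m < 2 ^ (k + 1) ^ 3 ∧ ∃ q : G.Q,
      2 ^ (((k + 1) ^ 3 - k ^ 3) / e) ≤
        G.gain (parityExtension h K hK (bits m)) (k ^ 3) q ((k + 1) ^ 3 - k ^ 3) := by
  simp only [gainSet, Finset.mem_filter, Finset.mem_range]

/-- If each position without a high power of a prime in its factorization can be toggled, then in a
late window the capital grows on average by at most a factor of `2` for each other position. -/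
theorem exists_forall_sum_gain_le {h : ℕ} (G : MultiheadFSG h Bool) {K : Finset ℕ}
    (hK : K ⊆ Finset.Icc 1 h) {b C : ℕ} {a : Fin (h - 1) → ℕ}
    (hpos : ∀ n i, b * G.pos n i ≤ a i * n + C ∧ a i * n ≤ b * G.pos n i + C)
    (htog : ∀ n, n ≠ 0 → ∃ Y, IsToggle (parityPrimes h K) n (speedPositions b a n) Y) (A : ℕ) :
    ∃ k₀, ∀ k, k₀ ≤ k → ∀ q : G.Q, ∀ j, k ^ 3 + j ≤ (k + 1) ^ 3 →
      ∑ m ∈ Finset.range (2 ^ (k + 1) ^ 3),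
        G.gain (parityExtension h K hK (bits m)) (k ^ 3) q j ≤
      2 ^ ((Finset.Ico (k ^ 3) (k ^ 3 + j)).filter
        fun n => ∃ r ∈ parityPrimes h K, r ^ A ∣ n).card * 2 ^ (k + 1) ^ 3 := by
  obtain ⟨k₀, hk₀⟩ := sameClass_pos G hpos (prime_of_mem_parityPrimes (h := h) (K := K)) A
  refine ⟨k₀ + 1, fun k hk q j => ?_⟩
  induction j with
  | zero => simp [MultiheadFSG.gain]
  | succ j ih =>
    intro hj
    have ih := ih (by omega)
    rw [← add_assoc, ← Finset.insert_Ico_right_eq_Ico_add_one (Nat.le_add_right _ _),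
      Finset.filter_insert]
    split_ifs with hA
    · rw [Finset.card_insert_of_notMem (by simp), pow_succ' 2 (Finset.card _), mul_assoc]
      exact (sum_gain_succ_le G _ _ _ _ _).trans (mul_le_mul_right ih 2)
    · push Not at hA
      have hk3 : 0 < k ^ 3 := pow_pos (by omega) 3
      have hlt : k ^ 3 + j < (k + 1) ^ 3 := by omega
      obtain ⟨Y, hY⟩ := htog (k ^ 3 + j) (by omega)
      obtain ⟨ρ, hρ, hρm⟩ := hY.exists_xor hK hlt
      rw [sum_gain_succ_eq G (fun m => parityExtension h K hK (bits m)) q hρ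
        fun m => (hρm m).1]
      · exact ih
      · intro m t ht
        refine (hρm m).2 _ (by omega) fun hc => ?_
        exact absurd hc (hk₀ k (by omega) _ (k ^ 3 + t) (by omega) (by omega) hlt hA).1
      · intro m t ht i
        refine (hρm m).2 _ ((G.pos_le _ i).trans_lt (by omega)) fun hc => ?_
        exact (hk₀ k (by omega) _ (k ^ 3 + t) (by omega) (by omega) hlt hA).2 i hc

/-- Markov's inequality for the gain in a window. -/
theorem exists_forall_card_gainSet_le {h : ℕ} (G : MultiheadFSG h Bool) {K : Finset ℕ}
    (hK : K ⊆ Finset.Icc 1 h) {b C : ℕ} {a : Fin (h - 1) → ℕ}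
    (hpos : ∀ n i, b * G.pos n i ≤ a i * n + C ∧ a i * n ≤ b * G.pos n i + C)
    (htog : ∀ n, n ≠ 0 → ∃ Y, IsToggle (parityPrimes h K) n (speedPositions b a n) Y)
    {e : ℕ} (he : 0 < e) :
    ∃ k₀, ∀ k, k₀ ≤ k → (gainSet G hK e k).card * 2 ^ (2 * k) ≤ 2 ^ (k + 1) ^ 3 := by
  classical
  have := G.finite_Q
  have := Fintype.ofFinite G.Q
  set I := parityPrimes h K with hI
  -- With this `A`, the proportion of exceptional positions is at most `|I| / 2 ^ A ≤ 1 / (2 * e)`.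
  set A := 2 * e * I.card with hA
  obtain ⟨k₀, hk₀⟩ := exists_forall_sum_gain_le G hK hpos htog A
  set c := 2 * I.card + Fintype.card G.Q with hc
  refine ⟨k₀ + 2 * e * (c + 2), fun k hk => ?_⟩
  have hk3 : k ^ 3 ≤ (k + 1) ^ 3 := Nat.pow_le_pow_left (Nat.le_succ k) 3
  set w := (k + 1) ^ 3 - k ^ 3 with hw
  have hweq : k ^ 3 + w = (k + 1) ^ 3 := by omega
  have hIpos : 0 < I.card := Finset.card_pos.2 ⟨_, Finset.mem_insert_self _ _⟩
  -- The exceptional positions cost less than half of the exponent `w / e`.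
  have hexp : Fintype.card G.Q + I.card * (w / 2 ^ A + 2) + 2 * k ≤ w / e := by
    have hk1 : 1 ≤ k := by nlinarith
    have h1 : w / 2 ^ A ≤ w / (2 * e) / I.card := by
      rw [Nat.div_div_eq_div_mul]
      exact Nat.div_le_div_left Nat.lt_two_pow_self.le (by positivity)
    have h2 : I.card * (w / 2 ^ A) ≤ w / (2 * e) :=
      (Nat.mul_le_mul_left _ h1).trans (Nat.mul_div_le _ _)
    have h3 : c + 2 * k ≤ w / (2 * e) := by
      rw [Nat.le_div_iff_mul_le (by positivity)]
      have h4 : k * k ≤ w := by nlinarith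
      have h5 : (c + 2 * k) * (2 * e) ≤ 2 * e * (c + 2) * k := by
        have : c ≤ c * k := Nat.le_mul_of_pos_right c hk1
        nlinarith
      have h6 : 2 * e * (c + 2) * k ≤ k * k := Nat.mul_le_mul_right k (by omega)
      omega
    have h7 : w / (2 * e) + w / (2 * e) ≤ w / e := by
      rw [Nat.le_div_iff_mul_le he]
      calc _ = 2 * e * (w / (2 * e)) := by ring
        _ ≤ w := Nat.mul_div_le _ _
    rw [mul_add]
    omega
  have hcount := card_filter_exists_pow_dvd_le (I := I) prime_of_mem_parityPrimes A (k ^ 3) w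
  set u := ((Finset.Ico (k ^ 3) (k ^ 3 + w)).filter
    fun n => ∃ r ∈ I, r ^ A ∣ n).card with hu
  set F : ℕ → ℕ → Bool := fun m => parityExtension h K hK (bits m) with hF
  have hsum : ((gainSet G hK e k).card : ℚ≥0) * 2 ^ (w / e) ≤
      Fintype.card G.Q * (2 ^ u * 2 ^ (k + 1) ^ 3) := by
    calc ((gainSet G hK e k).card : ℚ≥0) * 2 ^ (w / e)
        = ∑ _m ∈ gainSet G hK e k, 2 ^ (w / e) := by rw [Finset.sum_const, nsmul_eq_mul]
      _ ≤ ∑ m ∈ gainSet G hK e k, ∑ q, G.gain (F m) (k ^ 3) q w := by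
          refine Finset.sum_le_sum fun m hm => ?_
          obtain ⟨-, q, hq⟩ := mem_gainSet.1 hm
          exact hq.trans (Finset.single_le_sum (f := fun q => G.gain (F m) (k ^ 3) q w)
            (fun _ _ => zero_le) (Finset.mem_univ q))
      _ ≤ ∑ m ∈ Finset.range (2 ^ (k + 1) ^ 3), ∑ q, G.gain (F m) (k ^ 3) q w :=
          Finset.sum_le_sum_of_subset fun m hm => Finset.mem_range.2 (mem_gainSet.1 hm).1
      _ = ∑ q, ∑ m ∈ Finset.range (2 ^ (k + 1) ^ 3), G.gain (F m) (k ^ 3) q w :=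
          Finset.sum_comm
      _ ≤ ∑ _q : G.Q, 2 ^ u * 2 ^ (k + 1) ^ 3 :=
          Finset.sum_le_sum fun q _ => hk₀ k (by omega) q w hweq.le
      _ = _ := by rw [Finset.sum_const, nsmul_eq_mul, Finset.card_univ]
  have hsum' : (gainSet G hK e k).card * 2 ^ (w / e) ≤
      Fintype.card G.Q * (2 ^ u * 2 ^ (k + 1) ^ 3) := by exact_mod_cast hsum
  have hpow : Fintype.card G.Q * 2 ^ u * 2 ^ (2 * k) ≤ 2 ^ (w / e) := by
    calc _ ≤ 2 ^ Fintype.card G.Q * 2 ^ u * 2 ^ (2 * k) := by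
          gcongr
          exact Nat.lt_two_pow_self.le
      _ = 2 ^ (Fintype.card G.Q + u + 2 * k) := by rw [pow_add, pow_add]
      _ ≤ _ := Nat.pow_le_pow_right two_pos (by omega)
  have hfinal : 2 ^ (w / e) * ((gainSet G hK e k).card * 2 ^ (2 * k)) ≤
      2 ^ (w / e) * 2 ^ (k + 1) ^ 3 := by
    calc _ = (gainSet G hK e k).card * 2 ^ (w / e) * 2 ^ (2 * k) := by ring
      _ ≤ Fintype.card G.Q * (2 ^ u * 2 ^ (k + 1) ^ 3) * 2 ^ (2 * k) :=
          Nat.mul_le_mul_right _ hsum'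
      _ = Fintype.card G.Q * 2 ^ u * 2 ^ (2 * k) * 2 ^ (k + 1) ^ 3 := by ring
      _ ≤ _ := Nat.mul_le_mul_right _ hpow
  exact Nat.le_of_mul_le_mul_left hfinal (by positivity)

/-- With one trailing head less than there are indices, each gambler rarely gains on the sequences
of one of the two families: a set of `h - 1` heads cannot serve both index sets. -/
theorem exists_forall_card_gainSet_le_or {h : ℕ} (hh : 2 ≤ h) (G : MultiheadFSG h Bool)
    {e : ℕ} (he : 0 < e) :
    (∃ k₀, ∀ k, k₀ ≤ k → (gainSet G (Finset.Icc_subset_Icc_right (Nat.sub_le h 1)) e k).card *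
      2 ^ (2 * k) ≤ 2 ^ (k + 1) ^ 3) ∨
    (∃ k₀, ∀ k, k₀ ≤ k → (gainSet G (Finset.Icc_subset_Icc_left one_le_two) e k).card *
      2 ^ (2 * k) ≤ 2 ^ (k + 1) ^ 3) := by
  obtain ⟨b, a, C, hb, hpos⟩ := G.exists_speed
  have hK' : Finset.Icc 1 (h - 1) ⊆ Finset.Icc 1 h :=
    Finset.Icc_subset_Icc_right (Nat.sub_le h 1)
  rcases exists_isToggle_or hb a (I := parityPrimes h (Finset.Icc 1 (h - 1)))
    (J := parityPrimes h (Finset.Icc 2 h)) prime_of_mem_parityPrimes prime_of_mem_parityPrimes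
    (s := prm h) (t := prm (h + 1))
    (by rw [card_parityPrimes hK', Nat.card_Icc]; omega)
    (prm_notMem_parityPrimes hK' (by omega) (by omega) (by simp; omega))
    (Finset.mem_insert_of_mem (Finset.mem_image_of_mem _ (Finset.mem_Icc.2 ⟨hh, le_rfl⟩)))
    (Finset.mem_insert_self _ _)
    (prm_lt (Finset.mem_Icc.2 ⟨by omega, le_rfl⟩)).ne with htog | htog
  · exact Or.inl (exists_forall_card_gainSet_le G _ hpos htog he)
  · exact Or.inr (exists_forall_card_gainSet_le G _ hpos htog he)

/-! ### Sequences that avoid the gain sets -/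

/-- From some index on, no prefix of `R` of length `(k + 1) ^ 3` has a code in `B k`. -/
def Avoids (R : ℕ → Bool) (B : ℕ → Finset ℕ) : Prop :=
  ∃ k₁, ∀ k, k₁ ≤ k → ∀ m ∈ B k, ∃ i < (k + 1) ^ 3, bits m i ≠ R i

theorem exists_cube_le_lt (n : ℕ) : ∃ k, k ^ 3 ≤ n ∧ n < (k + 1) ^ 3 := by
  induction n with
  | zero => exact ⟨0, by norm_num⟩
  | succ n ih =>
    obtain ⟨k, hk, hn⟩ := ih
    rcases Nat.lt_or_ge (n + 1) ((k + 1) ^ 3) with h | h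
    · exact ⟨k, by omega, h⟩
    · exact ⟨k + 1, h, lt_of_le_of_lt hn (Nat.pow_lt_pow_left (Nat.lt_succ_self _) (by norm_num))⟩

theorem gain_le_of_forall_ne {h : ℕ} (G : MultiheadFSG h Bool) {K : Finset ℕ}
    (hK : K ⊆ Finset.Icc 1 h) {e k : ℕ} {R : ℕ → Bool}
    (hR : ∀ m ∈ gainSet G hK e k, ∃ i < (k + 1) ^ 3, bits m i ≠ R i) (q : G.Q) :
    G.gain (parityExtension h K hK R) (k ^ 3) q ((k + 1) ^ 3 - k ^ 3) ≤
      2 ^ (((k + 1) ^ 3 - k ^ 3) / e) := by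
  obtain ⟨m, hm, hmR⟩ := exists_bits_eq R ((k + 1) ^ 3)
  have hX : ∀ n < (k + 1) ^ 3,
      parityExtension h K hK R n = parityExtension h K hK (bits m) n := fun n hn =>
    parityExtension_congr hK n fun j hj => (hmR j (hj.trans_lt hn)).symm
  by_contra hlt
  rw [not_le, (G.run_congr q (fun t ht => hX _ (by omega)) fun t ht i => hX _
    ((G.pos_le _ i).trans_lt (by omega))).2] at hlt
  obtain ⟨i, hi, hne⟩ := hR m (mem_gainSet.2 ⟨hm, q, hlt.le⟩)
  exact hne (hmR i hi)

/-- On a sequence with avoidance the capital at time `n` is at most `2 ^ (n / e)`, up to the gain of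
one window, which is too short to matter. So a gale with `s < 1 - 1 / e` is bounded. -/
theorem notMem_successSet_of_avoids {h : ℕ} (G : MultiheadFSG h Bool) {K : Finset ℕ}
    (hK : K ⊆ Finset.Icc 1 h) {e : ℕ} (he : 0 < e) {R : ℕ → Bool} (hR : Avoids R (gainSet G hK e))
    {s : ℝ} (hs : s + 1 / e < 1) : parityExtension h K hK R ∉ successSet (G.gale s) := by
  obtain ⟨k₁, hk₁⟩ := hR
  set X := parityExtension h K hK R with hX
  set M : ℕ → ℝ≥0 := fun n => G.martingale n fun i => X i with hM
  have he' : (0 : ℝ) < e := Nat.cast_pos.2 he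
  have hstep : ∀ k, k₁ ≤ k → M ((k + 1) ^ 3) ≤
      M (k ^ 3) * 2 ^ ((((k + 1) ^ 3 - k ^ 3 : ℕ) : ℝ) / e) := by
    intro k hk
    have hk3 : k ^ 3 ≤ (k + 1) ^ 3 := Nat.pow_le_pow_left (Nat.le_succ k) 3
    have h1 := G.martingale_add X (k ^ 3) ((k + 1) ^ 3 - k ^ 3)
    rw [Nat.add_sub_cancel' hk3] at h1
    simp only [hM]
    rw [h1]
    refine mul_le_mul_right ?_ _
    have h2 := gain_le_of_forall_ne G hK (hk₁ k hk) (G.state (k ^ 3) fun i => X i).2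
    have h3 : ((G.gain X (k ^ 3) (G.state (k ^ 3) fun i => X i).2
        ((k + 1) ^ 3 - k ^ 3) : ℚ≥0) : ℝ≥0) ≤ ((2 ^ (((k + 1) ^ 3 - k ^ 3) / e) : ℚ≥0) : ℝ≥0) :=
      NNRat.cast_le.2 h2
    refine h3.trans ?_
    push_cast
    rw [← NNReal.rpow_natCast]
    exact NNReal.rpow_le_rpow_of_exponent_le one_le_two Nat.cast_div_le
  have hcube : ∀ k, k₁ ≤ k → M (k ^ 3) ≤ M (k₁ ^ 3) * 2 ^ (((k ^ 3 : ℕ) : ℝ) / e) := by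
    intro k hk
    induction k, hk using Nat.le_induction with
    | base =>
      refine le_mul_of_one_le_right zero_le ?_
      exact NNReal.one_le_rpow one_le_two (by positivity)
    | succ k hk ih =>
      refine (hstep k hk).trans ((mul_le_mul_left ih _).trans_eq ?_)
      have hk3 : k ^ 3 ≤ (k + 1) ^ 3 := Nat.pow_le_pow_left (Nat.le_succ k) 3
      rw [mul_assoc, ← NNReal.rpow_add two_ne_zero, Nat.cast_sub hk3]
      congr 2
      ring
  have hadd : ∀ n j, M (n + j) ≤ M n * 2 ^ (j : ℝ) := by
    intro n j
    simp only [hM]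
    rw [G.martingale_add X n j]
    refine mul_le_mul_right ?_ _
    have h3 : ((G.gain X n (G.state n fun i => X i).2 j : ℚ≥0) : ℝ≥0) ≤ ((2 ^ j : ℚ≥0) : ℝ≥0) :=
      NNRat.cast_le.2 (G.gain_le _ _ _ _)
    refine h3.trans_eq ?_
    push_cast
    rw [NNReal.rpow_natCast]
  set c : ℝ := 1 - s - 1 / e with hc
  have hcpos : 0 < c := by rw [hc]; linarith
  have hbound : ∀ n, k₁ ^ 3 ≤ n →
      G.gale s n (fun i => X i) ≤ M (k₁ ^ 3) * 2 ^ (7 * (7 / c) ^ 2) := by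
    intro n hn
    obtain ⟨k, hkn, hnk⟩ := exists_cube_le_lt n
    have hk : k₁ ≤ k := by
      by_contra hlt
      have : (k + 1) ^ 3 ≤ k₁ ^ 3 := Nat.pow_le_pow_left (by omega) 3
      omega
    obtain ⟨j, rfl⟩ := Nat.exists_eq_add_of_le hkn
    -- The offset `j` in the window is at most `3 * k ^ 2 + 3 * k`.
    have hj : j ≤ 7 * k ^ 2 := by nlinarith [Nat.le_self_pow two_ne_zero k]
    have h1 : M (k ^ 3 + j) ≤ M (k₁ ^ 3) * 2 ^ (((k ^ 3 : ℕ) : ℝ) / e) * 2 ^ (j : ℝ) :=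
      (hadd _ _).trans (mul_le_mul_left (hcube k hk) _)
    calc G.gale s (k ^ 3 + j) (fun i => X i)
        = 2 ^ ((s - 1) * ((k ^ 3 + j : ℕ) : ℝ)) * M (k ^ 3 + j) := by
          simp [MultiheadFSG.gale, hM]
      _ ≤ 2 ^ ((s - 1) * ((k ^ 3 + j : ℕ) : ℝ)) *
          (M (k₁ ^ 3) * 2 ^ (((k ^ 3 : ℕ) : ℝ) / e) * 2 ^ (j : ℝ)) := mul_le_mul_right h1 _
      _ = M (k₁ ^ 3) * 2 ^ ((s - 1) * ((k ^ 3 + j : ℕ) : ℝ) + ((k ^ 3 : ℕ) : ℝ) / e + j) := by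
          rw [NNReal.rpow_add two_ne_zero, NNReal.rpow_add two_ne_zero]
          ring
      _ ≤ _ := by
          refine mul_le_mul_right (NNReal.rpow_le_rpow_of_exponent_le one_le_two ?_) _
          push_cast
          have hj' : (j : ℝ) ≤ 7 * (k : ℝ) ^ 2 := by exact_mod_cast hj
          have hs1 : s ≤ 1 := by
            have : 0 < 1 / (e : ℝ) := by positivity
            linarith
          have e1 : (s - 1) * ((k : ℝ) ^ 3 + j) + (k : ℝ) ^ 3 / e + j =
              s * j - c * (k : ℝ) ^ 3 := by
            rw [hc]
            ring
          rw [e1]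
          -- The exponent is at most `k ^ 2 * (7 - c * k)`, which is negative for `k > 7 / c`.
          have e2 : s * j ≤ 7 * (k : ℝ) ^ 2 := by nlinarith [(Nat.cast_nonneg j : (0 : ℝ) ≤ j)]
          have e3 : s * j - c * (k : ℝ) ^ 3 ≤ (k : ℝ) ^ 2 * (7 - c * k) := by nlinarith
          refine e3.trans ?_
          have hk0 : (0 : ℝ) ≤ k := Nat.cast_nonneg k
          rcases le_total (7 / c) (k : ℝ) with h2 | h2
          · have : 7 ≤ c * k := by
              rw [div_le_iff₀ hcpos] at h2
              linarith
            have h3 : (k : ℝ) ^ 2 * (7 - c * k) ≤ 0 :=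
              mul_nonpos_of_nonneg_of_nonpos (by positivity) (by linarith)
            exact h3.trans (by positivity)
          · calc (k : ℝ) ^ 2 * (7 - c * k) ≤ (k : ℝ) ^ 2 * 7 :=
                  mul_le_mul_of_nonneg_left (by nlinarith) (by positivity)
              _ ≤ 7 * (7 / c) ^ 2 := by
                  have : (k : ℝ) ^ 2 ≤ (7 / c) ^ 2 := by gcongr
                  linarith
  intro hmem
  have hle : limsup (fun n : ℕ => (G.gale s n (fun i => X i) : ℝ≥0∞)) atTop ≤
      ((M (k₁ ^ 3) * 2 ^ (7 * (7 / c) ^ 2) : ℝ≥0) : ℝ≥0∞) := by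
    refine limsup_le_of_le (by isBoundedDefault) ?_
    filter_upwards [eventually_ge_atTop (k₁ ^ 3)] with n hn
    exact ENNReal.coe_le_coe.2 (hbound n hn)
  have hmem' : limsup (fun n : ℕ => (G.gale s n (fun i => X i) : ℝ≥0∞)) atTop = ⊤ := hmem
  rw [hmem', top_le_iff] at hle
  exact ENNReal.coe_ne_top hle

theorem sum_quarter_pow_lt (n : ℕ) : ∑ k ∈ Finset.Icc 1 n, (1 / 4 : ℚ) ^ k < 1 := by
  have h : ∀ n : ℕ, ∑ k ∈ Finset.Icc 1 n, (1 / 4 : ℚ) ^ k = (1 - (1 / 4) ^ n) / 3 := by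
    intro n
    induction n with
    | zero => simp
    | succ n ih =>
      rw [Finset.sum_Icc_succ_top (by omega), ih]
      ring
  rw [h n]
  have : (0 : ℚ) < (1 / 4) ^ n := by positivity
  linarith

/-- A union bound: the strings whose prefixes avoid finitely many of the sets exist. -/
theorem exists_bits_avoiding {B : ℕ → Finset ℕ} {k₁ : ℕ} (h1 : 1 ≤ k₁)
    (hBlt : ∀ k, ∀ m ∈ B k, m < 2 ^ (k + 1) ^ 3)
    (hB : ∀ k, k₁ ≤ k → (B k).card * 2 ^ (2 * k) ≤ 2 ^ (k + 1) ^ 3) (n : ℕ) :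
    ∃ R : ℕ → Bool, ∀ k, k₁ ≤ k → k ≤ n → ∀ m ∈ B k, ∃ i < (k + 1) ^ 3, bits m i ≠ R i := by
  set L : ℕ → ℕ := fun k => (k + 1) ^ 3 with hL
  have hLmono : Monotone L := fun x y hxy => Nat.pow_le_pow_left (by omega) 3
  -- `D k` codes the strings of length `L n` that have a prefix in `B k`.
  set D : ℕ → Finset ℕ := fun k => (Finset.range (2 ^ L n)).filter (· % 2 ^ L k ∈ B k) with hD
  have hDcard : ∀ k ∈ Finset.Icc k₁ n, ((D k).card : ℚ) ≤ 2 ^ L n * (1 / 4) ^ k := by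
    intro k hk
    rw [Finset.mem_Icc] at hk
    have hLk : L k ≤ L n := hLmono hk.2
    have hle : (D k).card ≤ (B k).card * 2 ^ (L n - L k) := by
      rw [← Finset.card_range (2 ^ (L n - L k)), ← Finset.card_product]
      refine Finset.card_le_card_of_injOn (fun m => (m % 2 ^ L k, m / 2 ^ L k)) ?_ ?_
      · intro m hm
        obtain ⟨hm, hmB⟩ := Finset.mem_filter.1 hm
        refine Finset.mem_coe.2 (Finset.mem_product.2 ⟨hmB, Finset.mem_range.2 ?_⟩)
        rw [Nat.div_lt_iff_lt_mul (by positivity), ← pow_add, Nat.sub_add_cancel hLk]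
        exact Finset.mem_range.1 hm
      · intro x _ y _ hxy
        rw [Prod.mk.injEq] at hxy
        rw [← Nat.mod_add_div x (2 ^ L k), ← Nat.mod_add_div y (2 ^ L k), hxy.1, hxy.2]
    have hle' : (D k).card * 4 ^ k ≤ 2 ^ L n := by
      calc (D k).card * 4 ^ k ≤ (B k).card * 2 ^ (L n - L k) * 4 ^ k := Nat.mul_le_mul_right _ hle
        _ = (B k).card * 2 ^ (2 * k) * 2 ^ (L n - L k) := by rw [pow_mul]; ring
        _ ≤ 2 ^ L k * 2 ^ (L n - L k) := Nat.mul_le_mul_right _ (hB k hk.1)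
        _ = 2 ^ L n := by rw [← pow_add, Nat.add_sub_cancel' hLk]
    have hle'' : ((D k).card : ℚ) * 4 ^ k ≤ 2 ^ L n := by exact_mod_cast hle'
    rw [one_div, inv_pow, ← div_eq_mul_inv, le_div_iff₀ (by positivity)]
    exact hle''
  have hcard : ((Finset.Icc k₁ n).biUnion D).card < (Finset.range (2 ^ L n)).card := by
    have hq : ((∑ k ∈ Finset.Icc k₁ n, (D k).card : ℕ) : ℚ) < 2 ^ L n := by
      push_cast
      calc ∑ k ∈ Finset.Icc k₁ n, ((D k).card : ℚ)
          ≤ ∑ k ∈ Finset.Icc k₁ n, 2 ^ L n * (1 / 4) ^ k := Finset.sum_le_sum hDcard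
        _ ≤ ∑ k ∈ Finset.Icc 1 n, 2 ^ L n * (1 / 4) ^ k :=
            Finset.sum_le_sum_of_subset_of_nonneg (Finset.Icc_subset_Icc_left h1)
              fun _ _ _ => by positivity
        _ = 2 ^ L n * ∑ k ∈ Finset.Icc 1 n, (1 / 4) ^ k := by rw [Finset.mul_sum]
        _ < 2 ^ L n := mul_lt_of_lt_one_right (by positivity) (sum_quarter_pow_lt n)
    rw [Finset.card_range]
    refine lt_of_le_of_lt Finset.card_biUnion_le ?_
    exact_mod_cast hq
  obtain ⟨m, hm, hmD⟩ := Finset.exists_mem_notMem_of_card_lt_card hcard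
  refine ⟨bits m, fun k hk hkn x hx => ?_⟩
  by_contra hall
  push Not at hall
  apply hmD
  refine Finset.mem_biUnion.2 ⟨k, Finset.mem_Icc.2 ⟨hk, hkn⟩, Finset.mem_filter.2 ⟨hm, ?_⟩⟩
  have hxlt := hBlt k x hx
  have : m % 2 ^ L k = x := by
    refine Nat.eq_of_testBit_eq fun i => ?_
    rw [Nat.testBit_mod_two_pow]
    by_cases hi : i < L k
    · rw [decide_eq_true hi, Bool.true_and]
      exact (hall i hi).symm
    · rw [decide_eq_false hi, Bool.false_and]
      exact (Nat.testBit_lt_two_pow (hxlt.trans_le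
        (Nat.pow_le_pow_right two_pos (not_lt.1 hi)))).symm
  rwa [this]

/-- Compactness gives a sequence all of whose late prefixes avoid the sets. -/
theorem exists_avoids {B : ℕ → Finset ℕ} {k₀ : ℕ}
    (hBlt : ∀ k, ∀ m ∈ B k, m < 2 ^ (k + 1) ^ 3)
    (hB : ∀ k, k₀ ≤ k → (B k).card * 2 ^ (2 * k) ≤ 2 ^ (k + 1) ^ 3) : ∃ R, Avoids R B := by
  set k₁ := max k₀ 1 with hk₁
  set F : ℕ → Set (ℕ → Bool) := fun n =>
    {R | ∀ k, k₁ ≤ k → k ≤ n → ∀ m ∈ B k, ∃ i < (k + 1) ^ 3, bits m i ≠ R i} with hF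
  have hclosed : ∀ n, IsClosed (F n) := by
    intro n
    have hFn : F n = ⋂ k, ⋂ (_ : k₁ ≤ k), ⋂ (_ : k ≤ n), ⋂ m ∈ B k,
        ⋃ i ∈ Finset.range ((k + 1) ^ 3), {R : ℕ → Bool | bits m i ≠ R i} := by
      ext R
      simp [hF]
    rw [hFn]
    refine isClosed_iInter fun k => isClosed_iInter fun _ => isClosed_iInter fun _ =>
      isClosed_iInter fun m => isClosed_iInter fun _ => isClosed_biUnion_finset fun i _ => ?_
    exact (isClosed_discrete {b : Bool | bits m i ≠ b}).preimage
      (continuous_apply (A := fun _ : ℕ => Bool) i)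
  obtain ⟨R, hR⟩ := IsCompact.nonempty_iInter_of_sequence_nonempty_isCompact_isClosed F
    (fun n R hR k hk hkn => hR k hk (by omega))
    (fun n => exists_bits_avoiding (le_max_right _ _) hBlt (fun k hk => hB k (by omega)) n)
    (hclosed 0).isCompact hclosed
  exact ⟨R, k₁, fun k hk => Set.mem_iInter.1 hR k k hk le_rfl⟩

/-! ### Gamblers that succeed -/

theorem mem_strongSuccessSet_of_le {h : ℕ} {G : MultiheadFSG h Bool} {s c d : ℝ} (hc : 0 < c)
    {S : ℕ → Bool} (hle : ∀ n : ℕ, 1 ≤ n → 2 ^ (c * n - d) ≤ G.gale s n fun i => S i) :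
    S ∈ strongSuccessSet (G.gale s) := by
  refine Tendsto.liminf_eq ?_
  have h1 : Tendsto (fun n : ℕ => (2 : ℝ≥0∞) ^ (c * n - d)) atTop (nhds ⊤) :=
    (ENNReal.tendsto_rpow_atTop_of_one_lt_base ENNReal.one_lt_two).comp
      (tendsto_atTop_add_const_right _ (-d) (tendsto_natCast_atTop_atTop.const_mul_atTop hc))
  refine tendsto_nhds_top_mono h1 ?_
  filter_upwards [eventually_ge_atTop 1] with n hn
  have h2 := ENNReal.coe_le_coe.2 (hle n hn)
  rwa [ENNReal.coe_rpow_of_ne_zero two_ne_zero] at h2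

theorem strongSuccessSet_subset {A : Type} (d : (n : ℕ) → (Fin n → A) → ℝ≥0) :
    strongSuccessSet d ⊆ successSet d := fun S hS =>
  top_le_iff.1 ((show _ = _ from hS).symm.trans_le
    (liminf_le_limsup (by isBoundedDefault) (by isBoundedDefault)))

/-- The gambler that bets uniformly. -/
def uniformGambler (h : ℕ) : MultiheadFSG h Bool where
  T := Unit
  Q := Unit
  finite_T := inferInstance
  finite_Q := inferInstance
  δT := id
  δQ := fun q _ _ => q
  μ := fun _ _ => false
  β := fun _ _ => 1 / 2
  sum_β := fun _ => by simp
  t₀ := ()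
  q₀ := ()
  c₀ := 1

theorem mem_strongSuccessSet_uniformGambler (h : ℕ) {s : ℝ} (hs : 1 < s) (S : ℕ → Bool) :
    S ∈ strongSuccessSet ((uniformGambler h).gale s) := by
  have hM : ∀ n, (uniformGambler h).martingale n (fun i => S i) = 1 := by
    intro n
    induction n with
    | zero => rfl
    | succ n ih =>
      have : (uniformGambler h).martingale (n + 1) (fun i => S i) =
        (Fintype.card Bool : ℝ≥0) * (uniformGambler h).martingale n (fun i => S i) *
        ((1 / 2 : ℚ≥0) : ℝ≥0) := rfl
      rw [this, ih]
      simp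
  refine mem_strongSuccessSet_of_le (c := s - 1) (d := 0) (by linarith) fun n _ => ?_
  rw [MultiheadFSG.gale, hM]
  simp

instance (i : ℕ) : NeZero (prm i) := ⟨(prime_prm i).ne_zero⟩

/-- The gambler for the sequences `parityExtension h K hK S`, with `p = prm (h + 1)`. The trailing
head with index `k ∈ K` has speed `prm k / p`: it advances when the residue of the time modulo `p`
is less than `prm k`, so that it reads position `q * prm k` at time `q * p - 1`. The betting state
is the residue of the time, and the parity of the bits under the trailing heads in the last step
(`none` before the first step); the gambler bets all on this parity when the residue is `0`. -/
noncomputable def parityGambler {h : ℕ} {K : Finset ℕ} (hcard : K.card = h - 1) :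
    MultiheadFSG h Bool where
  T := ZMod (prm (h + 1))
  Q := ZMod (prm (h + 1)) × Option Bool
  finite_T := inferInstance
  finite_Q := inferInstance
  δT := fun t => t + 1
  δQ := fun q σ _ => (q.1 + 1, some (∑ i, σ i))
  μ := fun t i => decide (t.val < prm ((Finset.equivFinOfCardEq hcard).symm i))
  β := fun q x => q.2.elim (1 / 2) fun b => if q.1 = 0 then if x = b then 1 else 0 else 1 / 2
  sum_β := by
    rintro ⟨r, _ | b⟩
    · simp
    · by_cases hr : r = 0
      · simp [hr]
      · simp [hr]
  t₀ := 0
  q₀ := (0, none)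
  c₀ := 1

section parityGambler

variable {h : ℕ} {K : Finset ℕ} (hK : K ⊆ Finset.Icc 1 h) (hcard : K.card = h - 1)

theorem parityGambler_iterate_δT (n : ℕ) :
    @Eq (ZMod (prm (h + 1))) ((parityGambler hcard).δT^[n] (parityGambler hcard).t₀) n := by
  induction n with
  | zero => exact (Nat.cast_zero (R := ZMod (prm (h + 1)))).symm
  | succ n ih =>
    rw [Function.iterate_succ_apply', Nat.cast_succ, ← ih]
    rfl

theorem parityGambler_pos_succ (n : ℕ) (i : Fin (h - 1)) :
    (parityGambler hcard).pos (n + 1) i = (parityGambler hcard).pos n i +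
      if n % prm (h + 1) < prm ((Finset.equivFinOfCardEq hcard).symm i) then 1 else 0 := by
  have h1 : ∀ t : ZMod (prm (h + 1)), (parityGambler hcard).μ t i =
      decide (t.val < prm ((Finset.equivFinOfCardEq hcard).symm i)) := fun _ => rfl
  have h2 : (parityGambler hcard).μ ((parityGambler hcard).δT^[n] (parityGambler hcard).t₀) i =
      decide (n % prm (h + 1) < prm ((Finset.equivFinOfCardEq hcard).symm i)) := by
    refine (h1 _).trans ?_
    rw [parityGambler_iterate_δT, ZMod.val_natCast]
  rw [MultiheadFSG.pos, h2]
  split_ifs with hlt <;> simp [hlt]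

include hK in
theorem parityGambler_pos (q r : ℕ) (hr : r ≤ prm (h + 1)) (i : Fin (h - 1)) :
    (parityGambler hcard).pos (q * prm (h + 1) + r) i =
      q * prm ((Finset.equivFinOfCardEq hcard).symm i) +
        min r (prm ((Finset.equivFinOfCardEq hcard).symm i)) := by
  have hlt := prm_lt (hK ((Finset.equivFinOfCardEq hcard).symm i).2)
  induction q generalizing r with
  | zero =>
    induction r with
    | zero => simp [MultiheadFSG.pos]
    | succ r ih =>
      rw [← add_assoc, parityGambler_pos_succ, ih (by omega), zero_mul, zero_add,
        Nat.mod_eq_of_lt (by omega)]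
      split_ifs <;> omega
  | succ q ihq =>
    induction r with
    | zero =>
      have := ihq (prm (h + 1)) le_rfl
      rw [← Nat.succ_mul] at this
      rw [add_zero, this, min_eq_right hlt.le, Nat.succ_mul]
      simp
    | succ r ih =>
      rw [← add_assoc, parityGambler_pos_succ, ih (by omega), Nat.mul_add_mod',
        Nat.mod_eq_of_lt (by omega)]
      split_ifs <;> omega

theorem parityGambler_state_succ (X : ℕ → Bool) (n : ℕ) :
    ((parityGambler hcard).state (n + 1) fun i => X i).2 =
      (((n + 1 : ℕ) : ZMod (prm (h + 1))), some (∑ i, X ((parityGambler hcard).pos n i))) := by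
  induction n with
  | zero =>
    have : ((parityGambler hcard).state (0 + 1) fun i => X i).2 =
        ((0 : ZMod (prm (h + 1))) + 1, some (∑ i, X ((parityGambler hcard).pos 0 i))) := rfl
    refine this.trans (congrArg (fun r => (r, _)) ?_)
    simp
  | succ n ih =>
    have : ((parityGambler hcard).state (n + 1 + 1) fun i => X i).2 =
        (((parityGambler hcard).state (n + 1) fun i => X i).2.1 + 1,
          some (∑ i, X ((parityGambler hcard).pos (n + 1) i))) := rfl
    rw [this, ih]
    push_cast
    rfl

include hK in
/-- The gambler doubles its capital at each positive multiple of `p`, and keeps it otherwise. -/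
theorem parityGambler_martingale (S : ℕ → Bool) (n : ℕ) :
    (parityGambler hcard).martingale (n + 1) (fun i => parityExtension h K hK S i) =
      2 ^ (n / prm (h + 1)) := by
  set X := parityExtension h K hK S with hX
  have hp := (prime_prm (h + 1)).pos
  induction n with
  | zero =>
    have : (parityGambler hcard).martingale (0 + 1) (fun i => X i) =
        (Fintype.card Bool : ℝ≥0) * 1 * ((1 / 2 : ℚ≥0) : ℝ≥0) := rfl
    rw [this]
    simp
  | succ n ih =>
    have h1 : (parityGambler hcard).martingale (n + 1 + 1) (fun i => X i) =
        (Fintype.card Bool : ℝ≥0) * (parityGambler hcard).martingale (n + 1) (fun i => X i) *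
        ((parityGambler hcard).β ((parityGambler hcard).state (n + 1) fun i => X i).2
          (X (n + 1)) : ℝ≥0) := rfl
    have h2 : ∀ (r : ZMod (prm (h + 1))) (b x : Bool), (parityGambler hcard).β (r, some b) x =
        if r = 0 then if x = b then 1 else 0 else 1 / 2 := fun _ _ _ => rfl
    rw [h1, ih, parityGambler_state_succ, h2, Nat.succ_div]
    by_cases hdvd : prm (h + 1) ∣ n + 1
    · have hbit : X (n + 1) = ∑ i, X ((parityGambler hcard).pos n i) := by
        obtain ⟨q, hq⟩ := hdvd
        obtain ⟨q, rfl⟩ : ∃ q', q = q' + 1 := Nat.exists_eq_succ_of_ne_zero <| by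
          rintro rfl
          simp at hq
        obtain ⟨c, hc⟩ : ∃ c, prm (h + 1) = c + 1 := ⟨_, (Nat.succ_pred_prime (prime_prm _)).symm⟩
        have hn : n = q * prm (h + 1) + c := by
          have : prm (h + 1) * (q + 1) = q * prm (h + 1) + prm (h + 1) := by ring
          omega
        have hpos : ∀ i, (parityGambler hcard).pos n i =
            (q + 1) * prm ((Finset.equivFinOfCardEq hcard).symm i) := by
          intro i
          have hlt := prm_lt (hK ((Finset.equivFinOfCardEq hcard).symm i).2)
          rw [hn, parityGambler_pos hK hcard q c (by omega), min_eq_right (by omega), Nat.succ_mul]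
        simp_rw [hpos]
        rw [hq, mul_comm, hX, parityExtension_mul h K hK S (q + 1) (Nat.succ_ne_zero q), ← hX,
          Equiv.sum_comp (Finset.equivFinOfCardEq hcard).symm
            fun k : K => X ((q + 1) * prm k)]
        exact (Finset.sum_coe_sort K fun k => X ((q + 1) * prm k)).symm
      rw [if_pos ((ZMod.natCast_eq_zero_iff _ _).2 hdvd), if_pos hbit, if_pos hdvd, pow_succ]
      simp [mul_comm]
    · rw [if_neg (fun h => hdvd ((ZMod.natCast_eq_zero_iff _ _).1 h)), if_neg hdvd, add_zero]
      simp [mul_comm]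

theorem parityExtension_mem_strongSuccessSet {s : ℝ} (hs : 1 - 1 / (prm (h + 1) : ℝ) < s)
    (S : ℕ → Bool) :
    parityExtension h K hK S ∈ strongSuccessSet ((parityGambler hcard).gale s) := by
  have hp := (prime_prm (h + 1)).pos
  have hp' : (0 : ℝ) < prm (h + 1) := Nat.cast_pos.2 hp
  refine mem_strongSuccessSet_of_le (c := s - 1 + 1 / (prm (h + 1) : ℝ)) (d := 1) (by linarith)
    fun n hn => ?_
  obtain ⟨n, rfl⟩ : ∃ n', n = n' + 1 := ⟨n - 1, by omega⟩
  rw [MultiheadFSG.gale, parityGambler_martingale hK hcard, Fintype.card_bool, ← NNReal.rpow_natCast]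
  push_cast
  rw [← NNReal.rpow_add two_ne_zero]
  refine NNReal.rpow_le_rpow_of_exponent_le one_le_two ?_
  have h1 : ((n : ℝ) + 1) ≤ ((n / prm (h + 1) : ℕ) + 1) * (prm (h + 1) : ℝ) := by
    have : n + 1 ≤ (n / prm (h + 1) + 1) * prm (h + 1) := Nat.lt_mul_of_div_lt (Nat.lt_succ_self _) hp
    exact_mod_cast this
  rw [← div_le_iff₀ hp'] at h1
  have h2 : (s - 1 + 1 / (prm (h + 1) : ℝ)) * (n + 1) - 1 =
      (s - 1) * (n + 1) + ((n + 1) / (prm (h + 1) : ℝ) - 1) := by ring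
  rw [h2]
  linarith

end parityGambler

/-! ### Bounds for the predimensions -/

theorem predim_le {h : ℕ} {E : Set (ℕ → Bool)} {x : ℝ} (hx : 0 ≤ x)
    (hE : ∀ s, x < s → ∃ G : MultiheadFSG h Bool, E ⊆ strongSuccessSet (G.gale s)) :
    predim h E ≤ x ∧ strongPredim h E ≤ x := by
  constructor
  · refine le_of_forall_gt_imp_ge_of_dense fun s hs => csInf_le ⟨0, fun _ hs => hs.1⟩ ?_
    obtain ⟨G, hG⟩ := hE s hs
    exact ⟨(hx.trans_lt hs).le, G, hG.trans (strongSuccessSet_subset _)⟩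
  · refine le_of_forall_gt_imp_ge_of_dense fun s hs => csInf_le ⟨0, fun _ hs => hs.1⟩ ?_
    obtain ⟨G, hG⟩ := hE s hs
    exact ⟨(hx.trans_lt hs).le, G, hG⟩

theorem predim_le_one (h : ℕ) (E : Set (ℕ → Bool)) : predim h E ≤ 1 ∧ strongPredim h E ≤ 1 :=
  predim_le zero_le_one fun _ hs =>
    ⟨uniformGambler h, fun S _ => mem_strongSuccessSet_uniformGambler h hs S⟩

theorem one_le_predim {h : ℕ} {E : Set (ℕ → Bool)}
    (hE : ∀ s, s < 1 → ∀ G : MultiheadFSG h Bool, ¬ E ⊆ successSet (G.gale s)) :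
    1 ≤ predim h E ∧ 1 ≤ strongPredim h E := by
  have h2 : E ⊆ strongSuccessSet ((uniformGambler h).gale 2) := fun S _ =>
    mem_strongSuccessSet_uniformGambler h one_lt_two S
  constructor
  · refine le_csInf ⟨2, zero_le_two, _, h2.trans (strongSuccessSet_subset _)⟩ ?_
    rintro s ⟨-, G, hG⟩
    exact not_lt.1 fun hs => hE s hs G hG
  · refine le_csInf ⟨2, zero_le_two, _, h2⟩ ?_
    rintro s ⟨-, G, hG⟩
    exact not_lt.1 fun hs => hE s hs G (hG.trans (strongSuccessSet_subset _))

theorem predim_le_of_subset_range {h : ℕ} {K : Finset ℕ} (hK : K ⊆ Finset.Icc 1 h)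
    (hcard : K.card = h - 1) {E : Set (ℕ → Bool)} (hE : E ⊆ Set.range (parityExtension h K hK)) :
    predim h E ≤ 1 - 1 / (prm (h + 1) : ℝ) ∧ strongPredim h E ≤ 1 - 1 / (prm (h + 1) : ℝ) := by
  refine predim_le ?_ fun s hs => ⟨parityGambler hcard, fun X hX => ?_⟩
  · have h1 : (1 : ℝ) ≤ prm (h + 1) := Nat.one_le_cast.2 (prime_prm (h + 1)).one_le
    have := div_le_one_of_le₀ h1 (zero_le_one.trans h1)
    linarith
  · obtain ⟨S, rfl⟩ := hE hX
    exact parityExtension_mem_strongSuccessSet hK hcard hs S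

/-! ### Martin-Löf random sequences avoid computable small sets -/

theorem primrec_nat_pow : Primrec₂ ((· ^ ·) : ℕ → ℕ → ℕ) := Primrec₂.unpaired'.1 Nat.Primrec.pow

theorem primrec_testBit : Primrec₂ Nat.testBit := by
  have h : PrimrecRel fun m i : ℕ => m / 2 ^ i % 2 = 1 :=
    Primrec.eq.comp (Primrec.nat_mod.comp (Primrec.nat_div.comp Primrec.fst
      (primrec_nat_pow.comp (Primrec.const 2) Primrec.snd)) (Primrec.const 2)) (Primrec.const 1)
  exact h.decide.of_eq fun m i => (Nat.testBit_eq_decide_div_mod_eq).symm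

/-- The list of the `n` lowest binary digits of `m`. -/
def bitList (n m : ℕ) : List Bool := (List.range n).map fun i => m.testBit i

theorem primrec_bitList : Primrec₂ bitList :=
  Primrec.list_map (Primrec.list_range.comp Primrec.fst)
    (primrec_testBit.comp (Primrec.snd.comp Primrec.fst) Primrec.snd)

theorem length_bitList (n m : ℕ) : (bitList n m).length = n := by simp [bitList]

theorem bitList_injOn (n : ℕ) : Set.InjOn (bitList n) {m | m < 2 ^ n} := by
  intro x hx y hy hxy
  refine Nat.eq_of_testBit_eq fun i => ?_
  by_cases hi : i < n
  · exact List.map_inj_left.1 hxy i (List.mem_range.2 hi)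
  · have hle := Nat.pow_le_pow_right two_pos (not_lt.1 hi)
    rw [Nat.testBit_lt_two_pow (lt_of_lt_of_le hx hle),
      Nat.testBit_lt_two_pow (lt_of_lt_of_le hy hle)]

theorem bitList_eq_ofFn {R : ℕ → Bool} {n m : ℕ} (h : ∀ i < n, bits m i = R i) :
    bitList n m = List.ofFn fun i : Fin n => R i := by
  refine List.ext_getElem (by simp [bitList]) fun i h1 h2 => ?_
  rw [length_bitList] at h1
  simp only [bitList, List.getElem_map, List.getElem_range, List.getElem_ofFn]
  exact h i h1

/-- The elements of `B k` that are less than `2 ^ (k + 1) ^ 3`, in increasing order. -/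
def codeList (B : ℕ → Finset ℕ) (k : ℕ) : List ℕ :=
  (List.range (2 ^ (k + 1) ^ 3)).filter fun m => m ∈ B k

/-- The machine that, on a program `1ᵏ 0 w` with `|w| = (k + 1) ^ 3 - 2 * k`, prints the string of
length `(k + 1) ^ 3` whose code is the element of `B k` with the index coded by `w`. -/
def decoder (B : ℕ → Finset ℕ) (π : List Bool) : Option (List Bool) :=
  if π.length = π.idxOf false + 1 + ((π.idxOf false + 1) ^ 3 - 2 * π.idxOf false) then
    (codeList B (π.idxOf false))[(List.range (2 ^ ((π.idxOf false + 1) ^ 3 -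
      2 * π.idxOf false))).findIdx fun i => decide (bitList ((π.idxOf false + 1) ^ 3 -
      2 * π.idxOf false) i = π.drop (π.idxOf false + 1))]?.map (bitList ((π.idxOf false + 1) ^ 3))
  else none

theorem primrec_decoder {B : ℕ → Finset ℕ} (hB : PrimrecRel fun m k => m ∈ B k) :
    Primrec (decoder B) := by
  have hk : Primrec fun π : List Bool => π.idxOf false :=
    Primrec.list_idxOf.comp (Primrec.const false) Primrec.id
  have hk1 : Primrec fun π : List Bool => π.idxOf false + 1 := Primrec.succ.comp hk
  have hN : Primrec fun π : List Bool => (π.idxOf false + 1) ^ 3 :=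
    primrec_nat_pow.comp hk1 (Primrec.const 3)
  have hl : Primrec fun π : List Bool => (π.idxOf false + 1) ^ 3 - 2 * π.idxOf false :=
    Primrec.nat_sub.comp hN (Primrec.nat_mul.comp (Primrec.const 2) hk)
  have hlist : Primrec fun π : List Bool => codeList B (π.idxOf false) :=
    (PrimrecRel.listFilter hB).comp
      (Primrec.list_range.comp (primrec_nat_pow.comp (Primrec.const 2) hN)) hk
  refine Primrec.ite (Primrec.eq.comp Primrec.list_length (Primrec.nat_add.comp hk1 hl))
    (Primrec.option_map (Primrec.list_getElem?.comp hlist (Primrec.list_findIdx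
      (Primrec.list_range.comp (primrec_nat_pow.comp (Primrec.const 2) hl)) ?_)) ?_)
    (Primrec.const none)
  · exact PrimrecPred.decide (Primrec.eq.comp
      (primrec_bitList.comp (hl.comp Primrec.fst) Primrec.snd)
      ((Primrec.list_drop.comp hk1 Primrec.id).comp Primrec.fst))
  · exact primrec_bitList.comp (hN.comp Primrec.fst) Primrec.snd

theorem isPrefixMachine_decoder {B : ℕ → Finset ℕ} (hB : PrimrecRel fun m k => m ∈ B k) :
    IsPrefixMachine fun π _ => (decoder B π : Part (List Bool)) := by
  refine ⟨Computable.ofOption ((primrec_decoder hB).to_comp.comp Computable.fst), ?_⟩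
  have hlen : ∀ π, (decoder B π : Part (List Bool)).Dom →
      π.length = π.idxOf false + 1 + ((π.idxOf false + 1) ^ 3 - 2 * π.idxOf false) := by
    intro π hπ
    by_contra hne
    rw [decoder, if_neg hne] at hπ
    exact hπ
  intro _ π₁ π₂ h₁ h₂ hpre
  have hl₁ := hlen π₁ h₁
  have hl₂ := hlen π₂ h₂
  refine hpre.eq_of_length ?_
  obtain ⟨t, rfl⟩ := hpre
  have hmem : false ∈ π₁ := List.idxOf_lt_length_iff.1 (by omega)
  rw [List.idxOf_append_of_mem hmem] at hl₂
  rw [hl₁, hl₂]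

theorem two_mul_lt_cube (k : ℕ) : 2 * k < (k + 1) ^ 3 := by
  have : (k + 1) ^ 3 = k ^ 3 + 3 * k ^ 2 + 3 * k + 1 := by ring
  omega

theorem exists_program {B : ℕ → Finset ℕ} (hBlt : ∀ k, ∀ m ∈ B k, m < 2 ^ (k + 1) ^ 3) {k m : ℕ}
    (hcard : (B k).card * 2 ^ (2 * k) ≤ 2 ^ (k + 1) ^ 3) (hm : m ∈ B k) :
    ∃ π : List Bool, π.length = k + 1 + ((k + 1) ^ 3 - 2 * k) ∧
      decoder B π = some (bitList ((k + 1) ^ 3) m) := by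
  set l := (k + 1) ^ 3 - 2 * k with hl
  have hmem : m ∈ codeList B k :=
    List.mem_filter.2 ⟨List.mem_range.2 (hBlt k m hm), decide_eq_true hm⟩
  obtain ⟨i, hi, him⟩ := List.getElem_of_mem hmem
  have hil : i < 2 ^ l := by
    have h1 : (codeList B k).length ≤ (B k).card := by
      rw [← List.toFinset_card_of_nodup (l := codeList B k) (List.nodup_range.filter _)]
      refine Finset.card_le_card fun x hx => ?_
      exact of_decide_eq_true (List.mem_filter.1 (List.mem_toFinset.1 hx)).2
    have h2 : (B k).card * 2 ^ (2 * k) ≤ 2 ^ l * 2 ^ (2 * k) := by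
      rwa [← pow_add, hl, Nat.sub_add_cancel (two_mul_lt_cube k).le]
    exact hi.trans_le (h1.trans (Nat.le_of_mul_le_mul_right h2 (by positivity)))
  set π := List.replicate k true ++ false :: bitList l i with hπ
  have hidx : π.idxOf false = k := by
    rw [hπ, List.idxOf_append_of_notMem (by simp), List.idxOf_cons_self]
    simp
  have hlen : π.length = k + 1 + l := by
    simp [hπ, length_bitList]
    ring
  have hdrop : π.drop (k + 1) = bitList l i := by
    rw [hπ, List.drop_append]
    simp
  refine ⟨π, hlen, ?_⟩
  have hfind : ((List.range (2 ^ l)).findIdx fun j => decide (bitList l j = bitList l i)) = i := by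
    rw [List.findIdx_eq (by simpa using hil)]
    refine ⟨by simp, fun j hj => ?_⟩
    simp only [List.getElem_range, decide_eq_false_iff_not]
    exact fun he => hj.ne (bitList_injOn l (hj.trans hil) hil he)
  rw [decoder, hidx, ← hl, hlen, if_pos rfl, hdrop, hfind, List.getElem?_eq_getElem hi, him]
  rfl

/-- The elements of small sets `B k` have short descriptions, so a Martin-Löf random sequence
eventually avoids the sets. -/
theorem IsMartinLofRandom.avoids {U : List Bool → List Bool →. List Bool}
    (hU : IsUniversalPrefixMachine U) {R : ℕ → Bool} (hR : IsMartinLofRandom U R)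
    {B : ℕ → Finset ℕ} (hprim : PrimrecRel fun m k => m ∈ B k)
    (hBlt : ∀ k, ∀ m ∈ B k, m < 2 ^ (k + 1) ^ 3) {k₀ : ℕ}
    (hB : ∀ k, k₀ ≤ k → (B k).card * 2 ^ (2 * k) ≤ 2 ^ (k + 1) ^ 3) : Avoids R B := by
  obtain ⟨c, hc⟩ := hR
  obtain ⟨c', hc'⟩ := hU.2 _ (isPrefixMachine_decoder hprim)
  refine ⟨k₀ + (c + c' + 2), fun k hk m hm => ?_⟩
  by_contra hall
  push Not at hall
  obtain ⟨π, hlen, hdec⟩ := exists_program hBlt (hB k (by omega)) hm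
  rw [bitList_eq_ofFn hall] at hdec
  have h1 : condK (fun π _ => (decoder B π : Part (List Bool)))
      (List.ofFn fun i : Fin ((k + 1) ^ 3) => R i) [] ≤ π.length := by
    refine iInf₂_le π ?_
    simp [hdec]
  have h2 : (((k + 1) ^ 3 : ℕ) : ℕ∞) ≤ π.length + c' + c :=
    (hc _).trans (by gcongr; exact (hc' _ _).trans (by gcongr))
  have h3 : (k + 1) ^ 3 ≤ π.length + c' + c := by exact_mod_cast h2
  have := two_mul_lt_cube k
  omega

/-! ### The gain sets are computable -/

theorem primrec_sum_bool {α : Type*} [Primcodable α] (K : Finset ℕ) {f : ℕ → α → Bool}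
    (hf : ∀ k, Primrec (f k)) : Primrec fun x => ∑ k ∈ K, f k x := by
  classical
  induction K using Finset.induction_on with
  | empty => simpa using Primrec.const (0 : Bool)
  | insert k K hk ih =>
    simp_rw [Finset.sum_insert hk]
    exact (Primrec.dom_bool₂ (fun x y : Bool => x + y)).comp (hf k) ih

theorem primrec_parityExtension {h : ℕ} {K : Finset ℕ} (hK : K ⊆ Finset.Icc 1 h) :
    Primrec₂ fun m n => parityExtension h K hK (bits m) n := by
  set p := prm (h + 1) with hp
  let g : ℕ → List Bool → Option Bool := fun m l =>
    some (if l.length = 0 then m.testBit 0 else if l.length % p = 0 then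
      ∑ k ∈ K, l.getD (l.length / p * prm k) false
      else m.testBit (l.length / p * (p - 1) + l.length % p))
  have hlen : Primrec fun x : ℕ × List Bool => x.2.length := Primrec.list_length.comp Primrec.snd
  have hdiv : Primrec fun x : ℕ × List Bool => x.2.length / p :=
    Primrec.nat_div.comp hlen (Primrec.const p)
  have hmod : Primrec fun x : ℕ × List Bool => x.2.length % p :=
    Primrec.nat_mod.comp hlen (Primrec.const p)
  have hg : Primrec₂ g := by
    refine Primrec.option_some.comp (Primrec.ite (Primrec.eq.comp hlen (Primrec.const 0))
      (primrec_testBit.comp Primrec.fst (Primrec.const 0))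
      (Primrec.ite (Primrec.eq.comp hmod (Primrec.const 0))
        (primrec_sum_bool K fun k => (Primrec.list_getD false).comp Primrec.snd
          (Primrec.nat_mul.comp hdiv (Primrec.const (prm k))))
        (primrec_testBit.comp Primrec.fst (Primrec.nat_add.comp
          (Primrec.nat_mul.comp hdiv (Primrec.const (p - 1))) hmod))))
  refine Primrec.nat_strong_rec _ hg fun m n => ?_
  simp only [g, List.length_map, List.length_range, Option.some.injEq]
  induction n using parity_induction hK with
  | zero => simp [parityExtension_zero, bits]
  | mul q hq ih =>
    have hppos : 0 < p := (prime_prm (h + 1)).pos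
    rw [if_neg (mul_ne_zero hq hppos.ne'), Nat.mul_mod_left, if_pos rfl,
      Nat.mul_div_cancel _ hppos, parityExtension_mul h K hK _ q hq]
    refine Finset.sum_congr rfl fun k hk => ?_
    have hlt : q * prm k < q * p := Nat.mul_lt_mul_of_pos_left (prm_lt (hK hk)) (by omega)
    rw [List.getD_eq_getElem _ _ (by simpa using hlt)]
    simp
  | add q r hr hrp =>
    have hppos : 0 < p := (prime_prm (h + 1)).pos
    have h1 : (q * p + r) % p = r := by rw [Nat.mul_add_mod', Nat.mod_eq_of_lt hrp]
    have h2 : (q * p + r) / p = q := by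
      rw [mul_comm, Nat.mul_add_div hppos, Nat.div_eq_of_lt hrp, add_zero]
    rw [if_neg (by omega), h1, h2, if_neg hr.ne', parityExtension_add h K hK _ q r hr hrp]
    rfl

namespace MultiheadFSG

variable {h : ℕ} (G : MultiheadFSG h Bool)

theorem primrec_pos (i : Fin (h - 1)) : Primrec fun n => G.pos n i := by
  have := G.finite_T
  let _ : Primcodable G.T := Primcodable.ofEquiv (Fin (Nat.card G.T)) (Finite.equivFin G.T)
  let f : ℕ → G.T × ℕ → G.T × ℕ := fun _ x => (G.δT x.1, x.2 + (G.μ x.1 i).toNat)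
  have hf : Primrec₂ f :=
    Primrec.pair ((Primrec.dom_finite G.δT).comp (Primrec.fst.comp Primrec.snd))
      (Primrec.nat_add.comp (Primrec.snd.comp Primrec.snd)
        ((Primrec.dom_finite fun t => (G.μ t i).toNat).comp (Primrec.fst.comp Primrec.snd)))
  refine (Primrec.snd.comp (Primrec.nat_rec₁ (G.t₀, 0) hf)).of_eq fun n => ?_
  suffices hs : (Nat.rec (G.t₀, 0) f n : G.T × ℕ) = (G.δT^[n] G.t₀, G.pos n i) by rw [hs]
  induction n with
  | zero => rfl
  | succ n ih =>
    rw [Function.iterate_succ_apply']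
    change f n (Nat.rec (G.t₀, 0) f n) = _
    rw [ih]
    rfl

/-- A common denominator for the values of the betting function. -/
theorem exists_denominator : ∃ (D : ℕ) (wt : G.Q → Bool → ℕ), 0 < D ∧
    ∀ q x, G.β q x * D = wt q x := by
  have := G.finite_Q
  have := Fintype.ofFinite G.Q
  set D := ∏ y : G.Q × Bool, (G.β y.1 y.2).den with hD
  have hdvd : ∀ q x, (G.β q x).den ∣ D := fun q x =>
    Finset.dvd_prod_of_mem (fun y : G.Q × Bool => (G.β y.1 y.2).den) (Finset.mem_univ (q, x))
  choose c hc using hdvd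
  refine ⟨D, fun q x => (G.β q x).num * c q x, Finset.prod_pos fun y _ => (G.β y.1 y.2).den_pos,
    fun q x => ?_⟩
  rw [hc q x]
  push_cast
  rw [← mul_assoc, NNRat.mul_den_eq_num]

/-- Betting state and numerator of the gain, in a run on `X` from time `N` in state `q`. -/
def integerRun (wt : G.Q → Bool → ℕ) (X : ℕ → Bool) (N : ℕ) (q : G.Q) (j : ℕ) : G.Q × ℕ :=
  Nat.rec (q, 1) (fun j x => (G.δQ x.1 (fun i => X (G.pos (N + j) i)) (X (N + j)),
    x.2 * (2 * wt x.1 (X (N + j))))) j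

theorem integerRun_fst (wt : G.Q → Bool → ℕ) (X : ℕ → Bool) (N : ℕ) (q : G.Q) (j : ℕ) :
    (G.integerRun wt X N q j).1 = G.betState X N q j := by
  induction j with
  | zero => rfl
  | succ j ih =>
    rw [betState, ← ih]
    rfl

theorem integerRun_snd {D : ℕ} {wt : G.Q → Bool → ℕ} (hwt : ∀ q x, G.β q x * D = wt q x)
    (X : ℕ → Bool) (N : ℕ) (q : G.Q) (j : ℕ) :
    ((G.integerRun wt X N q j).2 : ℚ≥0) = G.gain X N q j * D ^ j := by
  induction j with
  | zero => simp [integerRun, gain]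
  | succ j ih =>
    have h1 : (G.integerRun wt X N q (j + 1)).2 = (G.integerRun wt X N q j).2 *
        (2 * wt (G.integerRun wt X N q j).1 (X (N + j))) := rfl
    rw [h1, integerRun_fst, gain]
    push_cast
    rw [ih, ← hwt]
    ring

end MultiheadFSG

theorem primrecRel_mem_gainSet {h : ℕ} (G : MultiheadFSG h Bool) {K : Finset ℕ}
    (hK : K ⊆ Finset.Icc 1 h) (e : ℕ) : PrimrecRel fun m k => m ∈ gainSet G hK e k := by
  have := G.finite_Q
  have := Fintype.ofFinite G.Q
  let _ : Primcodable G.Q := Primcodable.ofEquiv (Fin (Nat.card G.Q)) (Finite.equivFin G.Q)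
  obtain ⟨D, wt, hD, hwt⟩ := G.exists_denominator
  set X : ℕ → ℕ → Bool := fun m => parityExtension h K hK (bits m) with hX
  have hXprim : Primrec₂ X := primrec_parityExtension hK
  have hcube : Primrec fun k : ℕ => k ^ 3 := primrec_nat_pow.comp Primrec.id (Primrec.const 3)
  have hcube' : Primrec fun k : ℕ => (k + 1) ^ 3 := hcube.comp Primrec.succ
  have hw : Primrec fun k : ℕ => (k + 1) ^ 3 - k ^ 3 := Primrec.nat_sub.comp hcube' hcube
  have hrun : Primrec fun y : G.Q × (ℕ × ℕ) =>
      G.integerRun wt (X y.2.1) (y.2.2 ^ 3) y.1 ((y.2.2 + 1) ^ 3 - y.2.2 ^ 3) := by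
    let f : G.Q × (ℕ × ℕ) → ℕ × (G.Q × ℕ) → G.Q × ℕ := fun y z =>
      (G.δQ z.2.1 (fun i => X y.2.1 (G.pos (y.2.2 ^ 3 + z.1) i)) (X y.2.1 (y.2.2 ^ 3 + z.1)),
        z.2.2 * (2 * wt z.2.1 (X y.2.1 (y.2.2 ^ 3 + z.1))))
    have hm : Primrec fun u : (G.Q × (ℕ × ℕ)) × (ℕ × (G.Q × ℕ)) => u.1.2.1 :=
      Primrec.fst.comp (Primrec.snd.comp Primrec.fst)
    have ht : Primrec fun u : (G.Q × (ℕ × ℕ)) × (ℕ × (G.Q × ℕ)) => u.1.2.2 ^ 3 + u.2.1 :=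
      Primrec.nat_add.comp (hcube.comp (Primrec.snd.comp (Primrec.snd.comp Primrec.fst)))
        (Primrec.fst.comp Primrec.snd)
    have hq : Primrec fun u : (G.Q × (ℕ × ℕ)) × (ℕ × (G.Q × ℕ)) => u.2.2.1 :=
      Primrec.fst.comp (Primrec.snd.comp Primrec.snd)
    have hlead : Primrec fun u : (G.Q × (ℕ × ℕ)) × (ℕ × (G.Q × ℕ)) =>
        X u.1.2.1 (u.1.2.2 ^ 3 + u.2.1) := hXprim.comp hm ht
    have htrail : Primrec fun u : (G.Q × (ℕ × ℕ)) × (ℕ × (G.Q × ℕ)) =>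
        fun i => X u.1.2.1 (G.pos (u.1.2.2 ^ 3 + u.2.1) i) :=
      Primrec.fin_curry.2 (Primrec₂.swap (Primrec.fin_curry₁.2 fun i =>
        hXprim.comp hm ((G.primrec_pos i).comp ht)))
    have hf : Primrec₂ f := by
      refine Primrec.pair ?_ ?_
      · exact (Primrec.dom_finite fun v : G.Q × (Fin (h - 1) → Bool) × Bool =>
          G.δQ v.1 v.2.1 v.2.2).comp (hq.pair (htrail.pair hlead))
      · exact Primrec.nat_mul.comp (Primrec.snd.comp (Primrec.snd.comp Primrec.snd))
          (Primrec.nat_mul.comp (Primrec.const 2)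
            ((Primrec.dom_finite fun v : G.Q × Bool => wt v.1 v.2).comp (hq.pair hlead)))
    exact Primrec.nat_rec' (hw.comp (Primrec.snd.comp Primrec.snd))
      (Primrec.fst.pair (Primrec.const 1)) hf
  have hrel : PrimrecRel fun (q : G.Q) (y : ℕ × ℕ) =>
      D ^ ((y.2 + 1) ^ 3 - y.2 ^ 3) * 2 ^ (((y.2 + 1) ^ 3 - y.2 ^ 3) / e) ≤
        (G.integerRun wt (X y.1) (y.2 ^ 3) q ((y.2 + 1) ^ 3 - y.2 ^ 3)).2 := by
    have hw' : Primrec fun u : G.Q × (ℕ × ℕ) => (u.2.2 + 1) ^ 3 - u.2.2 ^ 3 :=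
      hw.comp (Primrec.snd.comp Primrec.snd)
    exact Primrec.nat_le.comp (Primrec.nat_mul.comp (primrec_nat_pow.comp (Primrec.const D) hw')
      (primrec_nat_pow.comp (Primrec.const 2) (Primrec.nat_div.comp hw' (Primrec.const e))))
      (Primrec.snd.comp hrun)
  have hex := (PrimrecRel.exists_mem_list hrel).comp
    (Primrec.const (Finset.univ : Finset G.Q).toList) (Primrec.id (α := ℕ × ℕ))
  have hlt : PrimrecPred fun y : ℕ × ℕ => y.1 < 2 ^ (y.2 + 1) ^ 3 :=
    Primrec.nat_lt.comp Primrec.fst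
      (primrec_nat_pow.comp (Primrec.const 2) (hcube'.comp Primrec.snd))
  refine (hlt.and hex).of_eq fun y => ?_
  refine Iff.trans ?_ mem_gainSet.symm
  refine and_congr_right fun _ => ?_
  simp only [Finset.mem_toList, Finset.mem_univ, true_and, id]
  refine exists_congr fun q => ?_
  set w := (y.2 + 1) ^ 3 - y.2 ^ 3
  have hDw : (0 : ℚ≥0) < D ^ w := pow_pos (Nat.cast_pos.2 hD) w
  rw [← Nat.cast_le (α := ℚ≥0), G.integerRun_snd hwt]
  push_cast
  rw [mul_comm]
  exact mul_le_mul_iff_left₀ hDw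

/-! ### Two families that no gambler can serve together -/

theorem exists_add_one_div_lt {s : ℝ} (hs : s < 1) : ∃ e : ℕ, 0 < e ∧ s + 1 / (e : ℝ) < 1 := by
  obtain ⟨n, hn⟩ := exists_nat_one_div_lt (sub_pos.2 hs)
  refine ⟨n + 1, Nat.succ_pos n, ?_⟩
  push_cast
  linarith

/-- A set has predimensions at least `1` if for each gambler it contains extensions of both kinds of
a sequence that avoids those gain sets of the gambler that are small. -/
theorem one_le_predim_of_avoids {h : ℕ} (hh : 2 ≤ h) {E : Set (ℕ → Bool)}
    (hE : ∀ (G : MultiheadFSG h Bool) (K : Finset ℕ) (hK : K ⊆ Finset.Icc 1 h) (e : ℕ),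
      (∃ k₀, ∀ k, k₀ ≤ k → (gainSet G hK e k).card * 2 ^ (2 * k) ≤ 2 ^ (k + 1) ^ 3) →
      ∃ R, Avoids R (gainSet G hK e) ∧ (K = Finset.Icc 1 (h - 1) ∨ K = Finset.Icc 2 h →
        parityExtension h K hK R ∈ E)) :
    1 ≤ predim h E ∧ 1 ≤ strongPredim h E := by
  refine one_le_predim fun s hs G hG => ?_
  obtain ⟨e, he, hse⟩ := exists_add_one_div_lt hs
  rcases exists_forall_card_gainSet_le_or hh G he with hcard | hcard
  · obtain ⟨R, hR, hRE⟩ := hE G _ _ e hcard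
    exact notMem_successSet_of_avoids G _ he hR hse (hG (hRE (Or.inl rfl)))
  · obtain ⟨R, hR, hRE⟩ := hE G _ _ e hcard
    exact notMem_successSet_of_avoids G _ he hR hse (hG (hRE (Or.inr rfl)))

theorem predim_range_union_eq_one {h : ℕ} (hh : 2 ≤ h) :
    predim h (Set.range (Fprime h) ∪ Set.range (Fdoubleprime h)) = 1 ∧
    strongPredim h (Set.range (Fprime h) ∪ Set.range (Fdoubleprime h)) = 1 := by
  have hle := predim_le_one h (Set.range (Fprime h) ∪ Set.range (Fdoubleprime h))
  obtain ⟨h1, h2⟩ := one_le_predim_of_avoids hh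
    (E := Set.range (Fprime h) ∪ Set.range (Fdoubleprime h)) <| by
      rintro G K hK e ⟨k₀, hk₀⟩
      obtain ⟨R, hR⟩ := exists_avoids (fun k m hm => (mem_gainSet.1 hm).1) hk₀
      refine ⟨R, hR, ?_⟩
      rintro (rfl | rfl)
      · exact Or.inl ⟨R, rfl⟩
      · exact Or.inr ⟨R, rfl⟩
  exact ⟨hle.1.antisymm h1, hle.2.antisymm h2⟩

theorem predim_pair_eq_one {U : List Bool → List Bool →. List Bool}
    (hU : IsUniversalPrefixMachine U) {R : ℕ → Bool} (hR : IsMartinLofRandom U R) {h : ℕ}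
    (hh : 2 ≤ h) :
    predim h {Fprime h R, Fdoubleprime h R} = 1 ∧
    strongPredim h {Fprime h R, Fdoubleprime h R} = 1 := by
  have hle := predim_le_one h {Fprime h R, Fdoubleprime h R}
  obtain ⟨h1, h2⟩ := one_le_predim_of_avoids hh (E := {Fprime h R, Fdoubleprime h R}) <| by
      rintro G K hK e ⟨k₀, hk₀⟩
      refine ⟨R, hR.avoids hU (primrecRel_mem_gainSet G hK e)
        (fun k m hm => (mem_gainSet.1 hm).1) hk₀, ?_⟩
      rintro (rfl | rfl)
      · exact Or.inl rfl
      · exact Or.inr rfl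
  exact ⟨hle.1.antisymm h1, hle.2.antisymm h2⟩

theorem predim_le_of_subset_range_Fprime {h : ℕ} {E : Set (ℕ → Bool)}
    (hE : E ⊆ Set.range (Fprime h)) :
    predim h E ≤ 1 - 1 / (prm (h + 1) : ℝ) ∧ strongPredim h E ≤ 1 - 1 / (prm (h + 1) : ℝ) :=
  predim_le_of_subset_range _ (by simp) hE

theorem predim_le_of_subset_range_Fdoubleprime {h : ℕ} {E : Set (ℕ → Bool)}
    (hE : E ⊆ Set.range (Fdoubleprime h)) :
    predim h E ≤ 1 - 1 / (prm (h + 1) : ℝ) ∧ strongPredim h E ≤ 1 - 1 / (prm (h + 1) : ℝ) :=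
  predim_le_of_subset_range _ (by rw [Nat.card_Icc]; omega) hE

theorem theorem2 :
    (∀ h : ℕ, 2 ≤ h →
      ¬ StableUnderUnions (predim (A := Bool) h) ∧
      ¬ StableUnderUnions (strongPredim (A := Bool) h)) ∧
    (∀ U : List Bool → List Bool →. List Bool, IsUniversalPrefixMachine U →
      ∀ R : ℕ → Bool, IsMartinLofRandom U R →
      ∀ h : ℕ, 2 ≤ h →
        predim h {Fprime h R} ≤ 1 - 1 / (prm (h + 1) : ℝ) ∧
        strongPredim h {Fprime h R} ≤ 1 - 1 / (prm (h + 1) : ℝ) ∧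
        predim h {Fdoubleprime h R} ≤ 1 - 1 / (prm (h + 1) : ℝ) ∧
        strongPredim h {Fdoubleprime h R} ≤ 1 - 1 / (prm (h + 1) : ℝ) ∧
        predim h {Fprime h R, Fdoubleprime h R} = 1 ∧
        strongPredim h {Fprime h R, Fdoubleprime h R} = 1) := by
  refine ⟨fun h hh => ?_, fun U hU R hR h hh => ?_⟩
  · have h1 := predim_le_of_subset_range_Fprime (h := h) subset_rfl
    have h2 := predim_le_of_subset_range_Fdoubleprime (h := h) subset_rfl
    have h3 := predim_range_union_eq_one hh
    have hlt : 1 - 1 / (prm (h + 1) : ℝ) < 1 :=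
      sub_lt_self _ (one_div_pos.2 (Nat.cast_pos.2 (prime_prm (h + 1)).pos))
    exact ⟨fun hst => ((hst _ _).trans_lt (max_lt (h1.1.trans_lt hlt) (h2.1.trans_lt hlt))).ne h3.1,
      fun hst => ((hst _ _).trans_lt (max_lt (h1.2.trans_lt hlt) (h2.2.trans_lt hlt))).ne h3.2⟩
  · have h1 := predim_le_of_subset_range_Fprime (h := h) (E := {Fprime h R})
      (Set.singleton_subset_iff.2 ⟨R, rfl⟩)
    have h2 := predim_le_of_subset_range_Fdoubleprime (h := h) (E := {Fdoubleprime h R})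
      (Set.singleton_subset_iff.2 ⟨R, rfl⟩)
    exact ⟨h1.1, h1.2, h2.1, h2.2, predim_pair_eq_one hU hR hh⟩
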